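/- Let $\gamma,\gamma_1,\gamma_2,\delta_1,\delta_2\in\mathbb R$ with $\gamma_1,\delta_1>0$, and consider the Cauchy problem for the fifth order KdV--BBM equation for real-valued $\eta=\eta(x,t)$, $$\partial_t\eta+\partial_x\eta-\gamma_1\partial_t\partial_x^2\eta+\gamma_2\partial_x^3\eta+\delta_1\partial_t\partial_x^4\eta+\delta_2\partial_x^5\eta=-\tfrac34\partial_x(\eta^2)-\gamma\,\partial_x^3(\eta^2)+\tfrac7{48}\partial_x(\eta_x^2)+\tfrac18\partial_x(\eta^3),\qquad \eta(x,0)=\eta_0(x).$$ With $\widehat f(\xi)=\int_{\mathbb R} e^{-ix\xi}f(x)\,dx$ and $\langle\xi\rangle=\sqrt{1+\xi^2}$, let $H^{\sigma,2}(\mathbb R)$ be the space of real-valued $f\in L^2(\mathbb R)$ with $\|f\|_{H^{\sigma,2}}:=\|\cosh(\sigma|\xi|)\langle\xi\rangle^2\widehat f\|_{L^2_\xi}<\infty$. Put $D=-i\partial_x$, $\varphi(\xi)=1+\gamma_1\xi^2+\delta_1\xi^4$, $$\phi(\xi)=\frac{\xi(1-\gamma_2\xi^2+\delta_2\xi^4)}{\varphi(\xi)},\quad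 \tau(\xi)=\frac{\xi(3-4\gamma\xi^2)}{4\varphi(\xi)},\quad \psi(\xi)=\frac{\xi}{\varphi(\xi)},\quad F(\eta)=\tau(D)\eta^2-\tfrac7{48}\psi(D)\eta_x^2-\tfrac18\psi(D)\eta^3 .$$ A mild solution on $[0,T]$ with datum $\eta_0\in H^{\sigma,2}(\mathbb R)$ is an $\eta\in C([0,T];H^{\sigma,2}(\mathbb R))$ such that, for all $t\in[0,T]$, $$\eta(t)=e^{-it\phi(D)}\eta_0-i\int_0^t e^{-i(t-s)\phi(D)}F(\eta(s))\,ds .$$ **Theorem (local well-posedness).** There is a constant $c>0$, depending only on $\gamma,\gamma_1,\gamma_2,\delta_1,\delta_2$, such that the following holds for every $\sigma_0>0$ and every $\eta_0\in H^{\sigma_0,2}(\mathbb R)$. Let $$T=c\,\bigl(1+\|\eta_0\|_{H^{\sigma_0,2}(\mathbb R)}\bigr)^{-2}.$$ Then there is a unique mild solution $\eta\in C([0,T];H^{\sigma_0,2}(\mathbb R))$ with datum $\eta_0$. Moreover, the data-to-solution map is continuous: there is an open set $U\subseteq H^{\sigma_0,2}(\mathbb R)$ containing all $u_0$ with $\|u_0\|_{H^{\sigma_0,2}}\le\|\eta_0\|_{H^{\sigma_0,2}}$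 (in particular $\eta_0$) such that each $u_0\in U$ has a unique mild solution in $C([0,T];H^{\sigma_0,2}(\mathbb R))$, and the map $u_0\mapsto u$ from $U$ to $C([0,T];H^{\sigma_0,2}(\mathbb R))$ (with the supremum norm) is continuous. -/

import Mathlib

open MeasureTheory FourierTransform Set

noncomputable section

namespace KdVBBM

/-- The inclusion `L²(ℝ; ℝ) → L²(ℝ; ℂ)`. -/
def toComplex (f : Lp ℝ 2 (volume : Measure ℝ)) : Lp ℂ 2 (volume : Measure ℝ) :=
  Complex.ofRealCLM.compLp f

/-- The (Plancherel) Fourier transform of a real-valued `f ∈ L²(ℝ)`, in the normalization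
`f̂(ξ) = ∫ e^{-ixξ} f(x) dx`, so that `∂ₓ` corresponds to multiplication by `iξ`.
(Mathlib's `𝓕` uses the kernel `e^{-2πixξ}`.) -/
def hat (f : Lp ℝ 2 (volume : Measure ℝ)) (ξ : ℝ) : ℂ :=
  (𝓕 (toComplex f) : Lp ℂ 2 (volume : Measure ℝ)) (ξ / (2 * Real.pi))

/-- The Fourier transform `∫ e^{-ixξ} g(x) dx` of an integrable function. -/
def hatL1 (g : ℝ → ℂ) (ξ : ℝ) : ℂ :=
  ∫ x : ℝ, Complex.exp (-Complex.I * x * ξ) * g x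

/-- `⟨ξ⟩ = √(1 + ξ²)`. -/
def bracket (ξ : ℝ) : ℝ := √(1 + ξ ^ 2)

/-- The weight `cosh(σ|ξ|) ⟨ξ⟩^s`. -/
def weight (σ s ξ : ℝ) : ℝ := Real.cosh (σ * |ξ|) * bracket ξ ^ s

/-- `ξ ↦ cosh(σ|ξ|) ⟨ξ⟩^s f̂(ξ)`. -/
def weightedHat (σ s : ℝ) (f : Lp ℝ 2 (volume : Measure ℝ)) (ξ : ℝ) : ℂ :=
  (weight σ s ξ : ℂ) * hat f ξ

theorem bracket_pos (ξ : ℝ) : 0 < bracket ξ := Real.sqrt_pos.2 (by positivity)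

theorem weight_pos (σ s ξ : ℝ) : 0 < weight σ s ξ :=
  mul_pos (Real.cosh_pos _) (Real.rpow_pos_of_pos (bracket_pos ξ) s)

theorem toComplex_add (f g : Lp ℝ 2 (volume : Measure ℝ)) :
    toComplex (f + g) = toComplex f + toComplex g :=
  map_add (Complex.ofRealCLM.compLpₗ 2 (volume : Measure ℝ)) f g

theorem toComplex_smul (c : ℝ) (f : Lp ℝ 2 (volume : Measure ℝ)) :
    toComplex (c • f) = (c : ℂ) • toComplex f := by
  have h : toComplex (c • f) = c • toComplex f :=
    map_smul (Complex.ofRealCLM.compLpₗ 2 (volume : Measure ℝ)) c f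
  rw [h]
  rfl

theorem toComplex_injective : Function.Injective toComplex := by
  intro f g h
  apply Lp.ext
  have hf := Complex.ofRealCLM.coeFn_compLp f
  have hg := Complex.ofRealCLM.coeFn_compLp g
  have h' : Complex.ofRealCLM.compLp f = Complex.ofRealCLM.compLp g := h
  rw [h'] at hf
  filter_upwards [hf, hg] with x h1 h2
  have h3 : ((f x : ℝ) : ℂ) = ((g x : ℝ) : ℂ) := by
    simpa using h1.symm.trans h2
  exact_mod_cast h3

theorem qmp_mul {a : ℝ} (ha : a ≠ 0) :
    Measure.QuasiMeasurePreserving (fun x : ℝ => x * a) volume volume := by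
  refine ⟨by fun_prop, ?_⟩
  rw [Real.map_volume_mul_right ha]
  exact Measure.smul_absolutelyContinuous

theorem ae_div_two_pi {p : ℝ → Prop} (h : ∀ᵐ x : ℝ, p x) :
    ∀ᵐ ξ : ℝ, p (ξ / (2 * Real.pi)) := by
  simp only [div_eq_mul_inv]
  exact (qmp_mul (inv_ne_zero (by positivity))).ae h

theorem hat_add (f g : Lp ℝ 2 (volume : Measure ℝ)) :
    hat (f + g) =ᵐ[volume] fun ξ => hat f ξ + hat g ξ := by
  have h : 𝓕 (toComplex (f + g)) = 𝓕 (toComplex f) + 𝓕 (toComplex g) := by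
    rw [toComplex_add, FourierTransform.fourier_add]
  filter_upwards [ae_div_two_pi (Lp.coeFn_add (𝓕 (toComplex f)) (𝓕 (toComplex g)))] with ξ hξ
  simpa only [hat, h, Pi.add_apply] using hξ

theorem hat_smul (c : ℝ) (f : Lp ℝ 2 (volume : Measure ℝ)) :
    hat (c • f) =ᵐ[volume] fun ξ => (c : ℂ) * hat f ξ := by
  have h : 𝓕 (toComplex (c • f)) = (c : ℂ) • 𝓕 (toComplex f) := by
    rw [toComplex_smul, FourierTransform.fourier_smul]
  filter_upwards [ae_div_two_pi (Lp.coeFn_smul (c : ℂ) (𝓕 (toComplex f)))] with ξ hξ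
  simpa only [hat, h, Pi.smul_apply, smul_eq_mul] using hξ

theorem weightedHat_add (σ s : ℝ) (f g : Lp ℝ 2 (volume : Measure ℝ)) :
    weightedHat σ s (f + g) =ᵐ[volume] weightedHat σ s f + weightedHat σ s g := by
  filter_upwards [hat_add f g] with ξ hξ
  simp only [weightedHat, hξ, Pi.add_apply]
  ring

theorem weightedHat_smul (σ s c : ℝ) (f : Lp ℝ 2 (volume : Measure ℝ)) :
    weightedHat σ s (c • f) =ᵐ[volume] c • weightedHat σ s f := by
  filter_upwards [hat_smul c f] with ξ hξ
  simp only [weightedHat, hξ, Pi.smul_apply, Complex.real_smul]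
  ring

/-- The real-valued functions `f ∈ L²(ℝ)` with `cosh(σ|ξ|) ⟨ξ⟩^s f̂ ∈ L²`. -/
def gevreySubmodule (σ s : ℝ) : Submodule ℝ (Lp ℝ 2 (volume : Measure ℝ)) where
  carrier := {f | MemLp (weightedHat σ s f) 2 volume}
  add_mem' {f g} hf hg := (memLp_congr_ae (weightedHat_add σ s f g)).2 (hf.add hg)
  zero_mem' := by
    have h := weightedHat_smul σ s 0 0
    rw [zero_smul, zero_smul] at h
    exact (memLp_congr_ae h).2 MemLp.zero
  smul_mem' c f hf := (memLp_congr_ae (weightedHat_smul σ s c f)).2 (hf.const_smul c)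

/-- The modified Gevrey space `H^{σ,s}(ℝ)` of real-valued functions. It is a type of its own (not
an abbreviation for the submodule of `L²`), because it carries the norm
`‖f‖ = ‖cosh(σ|ξ|) ⟨ξ⟩^s f̂‖_{L²}` and not the one of `L²`. -/
def GevreyH (σ s : ℝ) : Type := ↥(gevreySubmodule σ s)

namespace GevreyH

variable {σ s : ℝ}

instance : AddCommGroup (GevreyH σ s) := inferInstanceAs (AddCommGroup ↥(gevreySubmodule σ s))

instance : Module ℝ (GevreyH σ s) := inferInstanceAs (Module ℝ ↥(gevreySubmodule σ s))

/-- The underlying element of `L²(ℝ; ℝ)`. -/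
def toL2 (f : GevreyH σ s) : Lp ℝ 2 (volume : Measure ℝ) := Subtype.val f

theorem memLp (f : GevreyH σ s) : MemLp (weightedHat σ s f.toL2) 2 volume := Subtype.property f

/-- The linear map `f ↦ cosh(σ|ξ|) ⟨ξ⟩^s f̂` into `L²(ℝ; ℂ)`. -/
def weighted (σ s : ℝ) : GevreyH σ s →ₗ[ℝ] Lp ℂ 2 (volume : Measure ℝ) where
  toFun f := f.memLp.toLp _
  map_add' f g := by
    rw [← MemLp.toLp_add, MemLp.toLp_eq_toLp_iff]
    exact weightedHat_add σ s f.toL2 g.toL2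
  map_smul' c f := by
    rw [RingHom.id_apply, ← MemLp.toLp_const_smul, MemLp.toLp_eq_toLp_iff]
    exact weightedHat_smul σ s c f.toL2

theorem weighted_injective (σ s : ℝ) : Function.Injective (weighted σ s) := by
  intro f g h
  have h1 : weightedHat σ s f.toL2 =ᵐ[volume] weightedHat σ s g.toL2 :=
    (MemLp.toLp_eq_toLp_iff f.memLp g.memLp).1 h
  have h2 : ∀ᵐ ξ : ℝ, hat f.toL2 ξ = hat g.toL2 ξ := by
    filter_upwards [h1] with ξ hξ
    exact mul_left_cancel₀ (by exact_mod_cast (weight_pos σ s ξ).ne') hξ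
  have h3 : 𝓕 (toComplex f.toL2) = 𝓕 (toComplex g.toL2) := by
    apply Lp.ext
    have := (qmp_mul (a := 2 * Real.pi) (by positivity)).ae h2
    filter_upwards [this] with x hx
    simpa only [hat, mul_div_cancel_right₀ x (show (2 * Real.pi) ≠ 0 by positivity)] using hx
  have h4 : toComplex f.toL2 = toComplex g.toL2 :=
    (Lp.fourierTransformₗᵢ ℝ ℂ).injective h3
  exact Subtype.ext (toComplex_injective h4)

/-- The norm `‖f‖ = ‖cosh(σ|ξ|) ⟨ξ⟩^s f̂‖_{L²}`. -/
instance : NormedAddCommGroup (GevreyH σ s) :=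
  NormedAddCommGroup.induced (GevreyH σ s) (Lp ℂ 2 (volume : Measure ℝ)) (weighted σ s)
    (weighted_injective σ s)

instance : NormedSpace ℝ (GevreyH σ s) :=
  NormedSpace.induced ℝ (GevreyH σ s) (Lp ℂ 2 (volume : Measure ℝ)) (weighted σ s)

theorem norm_eq (f : GevreyH σ s) :
    ‖f‖ = (eLpNorm (fun ξ => ((Real.cosh (σ * |ξ|) * √(1 + ξ ^ 2) ^ s : ℝ) : ℂ) * hat f.toL2 ξ)
      2 volume).toReal :=
  Lp.norm_toLp _ f.memLp

theorem memLp_deriv (f : GevreyH σ 2) :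
    MemLp (fun k : ℝ => (2 * Real.pi * Complex.I * k) *
      (𝓕 (toComplex f.toL2) : Lp ℂ 2 (volume : Measure ℝ)) k) 2 volume := by
  have h0 : (2 * Real.pi) ≠ 0 := by positivity
  have hm : MemLp (fun k : ℝ => weightedHat σ 2 f.toL2 (k * (2 * Real.pi))) 2 volume := by
    have h1 : MemLp (weightedHat σ 2 f.toL2) 2
        (Measure.map (fun x : ℝ => x * (2 * Real.pi)) volume) := by
      rw [Real.map_volume_mul_right h0]
      exact f.memLp.smul_measure ENNReal.ofReal_ne_top
    exact h1.comp_of_map (by fun_prop)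
  refine hm.of_le ?_ (Filter.Eventually.of_forall fun k => ?_)
  · exact (by fun_prop : AEStronglyMeasurable
      (fun k : ℝ => (2 * Real.pi * Complex.I * k : ℂ)) volume).mul (Lp.aestronglyMeasurable _)
  · simp only [weightedHat, hat, mul_div_cancel_right₀ k h0, norm_mul]
    gcongr
    have hw : |k * (2 * Real.pi)| ≤ weight σ 2 (k * (2 * Real.pi)) := by
      set ξ := k * (2 * Real.pi)
      have hb : bracket ξ ^ (2 : ℝ) = 1 + ξ ^ 2 := by
        rw [Real.rpow_two, bracket, Real.sq_sqrt (by positivity)]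
      have h1 : |ξ| ≤ 1 + ξ ^ 2 := by nlinarith [sq_abs ξ, sq_nonneg (|ξ| - 1)]
      have h2 := Real.one_le_cosh (σ * |ξ|)
      rw [weight, hb]
      nlinarith [sq_nonneg ξ]
    calc ‖(2 : ℂ)‖ * ‖(Real.pi : ℂ)‖ * ‖Complex.I‖ * ‖(k : ℂ)‖ = |k * (2 * Real.pi)| := by
          simp [abs_mul, abs_of_pos Real.pi_pos]
          ring
      _ ≤ weight σ 2 (k * (2 * Real.pi)) := hw
      _ = ‖(weight σ 2 (k * (2 * Real.pi)) : ℂ)‖ := by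
          rw [Complex.norm_real, Real.norm_of_nonneg (weight_pos _ _ _).le]

/-- The derivative `∂ₓ f ∈ L²(ℝ)` of `f ∈ H^{σ,2}(ℝ)`: the inverse Fourier transform of
`iξ f̂(ξ)` (in Mathlib's normalization, of `2πik (𝓕 f)(k)`). -/
def dx (f : GevreyH σ 2) : Lp ℂ 2 (volume : Measure ℝ) :=
  𝓕⁻ (f.memLp_deriv.toLp _ : Lp ℂ 2 (volume : Measure ℝ))

end GevreyH

/-- The coefficients of the fifth order KdV-BBM equation
`∂ₜη + ∂ₓη - γ₁ ∂ₜ∂ₓ²η + γ₂ ∂ₓ³η + δ₁ ∂ₜ∂ₓ⁴η + δ₂ ∂ₓ⁵η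
  = - (3/4) ∂ₓ(η²) - γ ∂ₓ³(η²) + (7/48) ∂ₓ(ηₓ²) + (1/8) ∂ₓ(η³)`. -/
structure Coeffs where
  γ : ℝ
  γ₁ : ℝ
  γ₂ : ℝ
  δ₁ : ℝ
  δ₂ : ℝ

namespace Coeffs

/-- `1 + γ₁ ξ² + δ₁ ξ⁴`, the denominator of the symbols below. -/
def denom (p : Coeffs) (ξ : ℝ) : ℝ := 1 + p.γ₁ * ξ ^ 2 + p.δ₁ * ξ ^ 4

/-- The symbol `ξ (1 - γ₂ ξ² + δ₂ ξ⁴) / (1 + γ₁ ξ² + δ₁ ξ⁴)` of the linear part. -/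
def phi (p : Coeffs) (ξ : ℝ) : ℝ := ξ * (1 - p.γ₂ * ξ ^ 2 + p.δ₂ * ξ ^ 4) / p.denom ξ

/-- The symbol `ξ (3 - 4γ ξ²) / (4 (1 + γ₁ ξ² + δ₁ ξ⁴))`. -/
def tau (p : Coeffs) (ξ : ℝ) : ℝ := ξ * (3 - 4 * p.γ * ξ ^ 2) / (4 * p.denom ξ)

/-- The symbol `ξ / (1 + γ₁ ξ² + δ₁ ξ⁴)`. -/
def psi (p : Coeffs) (ξ : ℝ) : ℝ := ξ / p.denom ξ

/-- The Fourier transform of `F(u) = τ(D) u² - (7/48) ψ(D) uₓ² - (1/8) ψ(D) u³`. For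
`u ∈ H^{σ,2}(ℝ)` the functions `u²`, `uₓ²` and `u³` are integrable. -/
def nonlinHat (p : Coeffs) {σ : ℝ} (u : GevreyH σ 2) (ξ : ℝ) : ℂ :=
  p.tau ξ * hatL1 (fun x => (toComplex u.toL2 x) ^ 2) ξ
    - 7 / 48 * p.psi ξ * hatL1 (fun x => (u.dx x) ^ 2) ξ
    - 1 / 8 * p.psi ξ * hatL1 (fun x => (toComplex u.toL2 x) ^ 3) ξ

end Coeffs

open Classical in
/-- The extension by zero to `ℝ` of a curve defined on `[0, T]`. -/
def extendZero {E : Type} [Zero E] [TopologicalSpace E] {T : ℝ} (η : C(Icc (0 : ℝ) T, E))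
    (s : ℝ) : E :=
  if h : s ∈ Icc (0 : ℝ) T then η ⟨s, h⟩ else 0

/-- `η ∈ C([0,T]; H^{σ,2}(ℝ))` is a mild solution with initial datum `η₀`:
`η(t) = e^{-itφ(D)} η₀ - i ∫₀ᵗ e^{-i(t-s)φ(D)} F(η(s)) ds` for all `t ∈ [0,T]`, the Fourier
multipliers and the time integral being evaluated on the Fourier side. -/
def IsMildSolution (p : Coeffs) {σ T : ℝ} (η₀ : GevreyH σ 2)
    (η : C(Icc (0 : ℝ) T, GevreyH σ 2)) : Prop :=
  ∀ t : Icc (0 : ℝ) T, ∀ᵐ ξ : ℝ,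
    hat (η t).toL2 ξ =
      Complex.exp (-Complex.I * (t : ℝ) * p.phi ξ) * hat η₀.toL2 ξ
        - Complex.I * ∫ s in (0 : ℝ)..t,
            Complex.exp (-Complex.I * ((t : ℝ) - s) * p.phi ξ) * p.nonlinHat (extendZero η s) ξ

end KdVBBM

end

/-!
Since `cosh (a + b) ≤ 2 cosh a cosh b`, Cauchy–Schwarz in the convolution bounds the weighted
Fourier transform of a product of two functions of `H^{σ,s}` uniformly in `ξ`, with constants that
do not depend on `σ`. The symbols of `τ(D)` and `∂ₓψ(D)` decay fast enough to leave a spare factor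
`⟨ξ⟩⁻¹ ∈ L²`, so `F` is Lipschitz on the ball of radius `r` with constant `≲ r + r²`. The
propagator `e^{-itφ(D)}` is a strongly continuous group of isometries; conjugating by it turns the
mild equation into an ordinary differential equation with the same Lipschitz constants.
Picard–Lindelöf on the ball of radius `2R` around `0`, with `R = 1 + ‖η₀‖`, gives solutions up to a
time of order `R⁻²` that depend Lipschitz continuously on the datum, and Grönwall's inequality gives
uniqueness. By Fubini, the `H^{σ,2}`-valued time integral has the Fourier transform obtained by
integrating frequency by frequency, as in the definition of a mild solution.
-/

noncomputable section

namespace KdVBBM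

section Plancherel

/-- The space of complex-valued square-integrable functions. -/
abbrev L2C (V : Type*) [MeasureSpace V] : Type _ := Lp ℂ 2 (volume : Measure V)

variable {V : Type*} [NormedAddCommGroup V] [InnerProductSpace ℝ V] [FiniteDimensional ℝ V]
  [MeasurableSpace V] [BorelSpace V]

theorem continuous_integral_mul {α : Type*} [MeasurableSpace α] {μ : Measure α} {p q : ENNReal}
    [Fact (1 ≤ p)] [Fact (1 ≤ q)] [p.HolderConjugate q] :
    Continuous fun u : Lp ℂ p μ × Lp ℂ q μ => ∫ x, u.1 x * u.2 x ∂μ := by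
  have h (u : Lp ℂ p μ × Lp ℂ q μ) :
      (ContinuousLinearMap.mul ℂ ℂ).lpPairing μ p q u.1 u.2 = ∫ x, u.1 x * u.2 x ∂μ :=
    ContinuousLinearMap.lpPairing_eq_integral _ _ _
  simp only [← h]
  fun_prop

theorem continuous_integral_mul_comp_sub_left (k : V) :
    Continuous fun u : L2C V × L2C V => ∫ y, u.1 y * u.2 (k - y) := by
  have hmp := Measure.measurePreserving_sub_left (volume : Measure V) k
  have h (u : L2C V × L2C V) :
      ∫ y, u.1 y * Lp.compMeasurePreserving _ hmp u.2 y = ∫ y, u.1 y * u.2 (k - y) := by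
    refine integral_congr_ae ?_
    filter_upwards [Lp.coeFn_compMeasurePreserving u.2 hmp] with y hy
    rw [hy, Function.comp_apply]
  simp only [← h]
  exact continuous_integral_mul.comp <| continuous_fst.prodMk <|
    (Lp.compMeasurePreservingₗᵢ ℂ _ hmp).continuous.comp continuous_snd

theorem continuous_fourier_mul (k : V) :
    Continuous fun u : L2C V × L2C V => 𝓕 (fun x => u.1 x * u.2 x) k := by
  let B := ContinuousLinearMap.mul ℂ ℂ
  have h (u : L2C V × L2C V) :
      Real.Lp.fourierTransformCLM V ℂ (B.holderL volume 2 2 1 u.1 u.2) k =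
        𝓕 (fun x => u.1 x * u.2 x) k :=
    Real.fourier_congr_ae (B.coeFn_holder (r := 1) u.1 u.2) k
  simp only [← h]
  exact (BoundedContinuousFunction.evalCLM ℂ k ∘L Real.Lp.fourierTransformCLM V ℂ).continuous.comp
    (B.holderL (volume : Measure V) 2 2 1).continuous₂

theorem fourier_fourier_schwartz (f : SchwartzMap V ℂ) (x : V) : 𝓕 (𝓕 f) x = f (-x) := by
  have h : f (-x) = 𝓕⁻ (𝓕 f) (-x) := by rw [fourierInv_fourier_eq]
  rw [h, SchwartzMap.fourierInv_coe, Real.fourierInv_eq_fourier_neg, neg_neg,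
    SchwartzMap.fourier_coe]

theorem fourier_mul_schwartz (f g : SchwartzMap V ℂ) (k : V) :
    𝓕 (fun x => f x * g x) k = ∫ y, 𝓕 f y * 𝓕 g (k - y) := by
  let B := ContinuousLinearMap.mul ℂ ℂ
  calc 𝓕 (fun x => f x * g x) k
      = 𝓕⁻ (fun x => f (-x) * g (-x)) k := by
        rw [Real.fourierInv_eq_fourier_comp_neg]; simp
    _ = SchwartzMap.convolution B (𝓕 f) (𝓕 g) k := by
        simp only [SchwartzMap.convolution, LinearMap.coe_mk, AddHom.coe_mk,
          ContinuousLinearMap.comp_apply, fourierCLM_apply, fourierInvCLM_apply,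
          SchwartzMap.fourierInv_coe]
        refine congrFun (congrArg _ (funext fun x => ?_)) k
        simp [fourier_fourier_schwartz, SchwartzMap.pairing_apply_apply, B]
    _ = ∫ y, 𝓕 f y * 𝓕 g (k - y) := SchwartzMap.convolution_apply _ _ _ _

theorem fourier_mul_eq_integral (f g : L2C V) (k : V) :
    𝓕 (fun x => f x * g x) k =
      ∫ y, (𝓕 f : L2C V) y * (𝓕 g : L2C V) (k - y) := by
  have hdense : DenseRange (SchwartzMap.toLpCLM ℂ (E := V) ℂ 2 volume) :=
    SchwartzMap.denseRange_toLpCLM ENNReal.ofNat_ne_top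
  refine hdense.induction_on₂ (p := fun f g : L2C V => 𝓕 (fun x => f x * g x) k =
    ∫ y, (𝓕 f : L2C V) y * (𝓕 g : L2C V) (k - y)) ?_ (fun f g => ?_) f g
  · exact isClosed_eq (continuous_fourier_mul k) <|
      (continuous_integral_mul_comp_sub_left k).comp <|
        (continuous_fourier.comp continuous_fst).prodMk (continuous_fourier.comp continuous_snd)
  · simp only [SchwartzMap.toLpCLM_apply, SchwartzMap.toLp_fourier_eq]
    have hmul : (fun x => f.toLp 2 volume x * g.toLp 2 volume x) =ᵐ[volume]
        fun x => f x * g x := by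
      filter_upwards [f.coeFn_toLp 2 volume, g.coeFn_toLp 2 volume] with x hf hg
      rw [hf, hg]
    rw [Real.fourier_congr_ae hmul, fourier_mul_schwartz]
    refine integral_congr_ae ?_
    filter_upwards [(𝓕 f).coeFn_toLp 2 volume,
      (Measure.measurePreserving_sub_left volume k).quasiMeasurePreserving.ae
        ((𝓕 g).coeFn_toLp 2 volume)] with x hf hg
    rw [hf, hg]

theorem integral_mul_eq_integral_fourier (f g : L2C V) :
    ∫ x, f x * g x = ∫ y, (𝓕 f : L2C V) y * (𝓕 g : L2C V) (-y) := by
  simpa [Real.fourier_eq] using fourier_mul_eq_integral f g 0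

theorem fourier_star (f : L2C V) :
    (𝓕 (star f) : L2C V) =ᵐ[volume]
      fun y => star ((𝓕 f : L2C V) (-y)) := by
  have hneg := Measure.measurePreserving_neg (volume : Measure V)
  set F : L2C V := Lp.compMeasurePreserving _ hneg (𝓕 (star f))
  have hF : F =ᵐ[volume] fun y => (𝓕 (star f) : L2C V) (-y) :=
    Lp.coeFn_compMeasurePreserving _ hneg
  have hstar : star F = 𝓕 f := by
    refine ext_inner_right ℂ fun G' => ?_
    obtain ⟨G, rfl⟩ : ∃ G : L2C V, 𝓕 G = G' := ⟨𝓕⁻ G', fourier_fourierInv_eq G'⟩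
    calc inner ℂ (star F) (𝓕 G)
        = ∫ y, (𝓕 (star f) : L2C V) (-y) * (𝓕 G : L2C V) y := by
          rw [L2.inner_def]
          refine integral_congr_ae ?_
          filter_upwards [Lp.coeFn_star F, hF] with y h1 h2
          rw [h1, Pi.star_apply, h2]
          simp [mul_comm]
      _ = ∫ x, (star f : L2C V) x * G x := by
          rw [integral_mul_eq_integral_fourier, ← integral_neg_eq_self]
          simp
      _ = inner ℂ f G := by
          rw [L2.inner_def]
          refine integral_congr_ae ?_
          filter_upwards [Lp.coeFn_star f] with x hx
          simp [hx, mul_comm]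
      _ = inner ℂ (𝓕 f) (𝓕 G) := (Lp.inner_fourier_eq f G).symm
  have h : (𝓕 f : L2C V) =ᵐ[volume] fun y =>
      star ((𝓕 (star f) : L2C V) (-y)) := by
    rw [← hstar]
    filter_upwards [Lp.coeFn_star F, hF] with y h1 h2
    rw [h1, Pi.star_apply, h2]
  filter_upwards [hneg.quasiMeasurePreserving.ae h] with y hy
  rw [hy, neg_neg, star_star]

variable {F : Type*} [NormedAddCommGroup F] [InnerProductSpace ℂ F] [CompleteSpace F]

theorem integral_fourier_schwartz_smul (φ : SchwartzMap V ℂ) (f : Lp F 2 (volume : Measure V)) :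
    ∫ x, 𝓕 φ x • f x = ∫ y, φ y • (𝓕 f : Lp F 2 (volume : Measure V)) y := by
  simpa [TemperedDistribution.fourier_apply] using
    DFunLike.congr_fun (Lp.fourier_toTemperedDistribution_eq f) φ

theorem ae_eq_of_integral_fourier_schwartz_smul_eq {f g : V → F} (hf : LocallyIntegrable f)
    (hg : LocallyIntegrable g)
    (h : ∀ φ : SchwartzMap V ℂ, ∫ x, 𝓕 φ x • f x = ∫ x, 𝓕 φ x • g x) : f =ᵐ[volume] g := by
  refine ae_eq_of_integral_contDiff_smul_eq hf hg fun χ hχ hs => ?_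
  have hs' : HasCompactSupport fun x => (χ x : ℂ) := hs.comp_left (g := Complex.ofReal) rfl
  have hχ' : ContDiff ℝ (⊤ : ℕ∞) fun x => (χ x : ℂ) := Complex.ofRealCLM.contDiff.comp hχ
  have key := h (𝓕⁻ (hs'.toSchwartzMap hχ'))
  rw [fourier_fourierInv_eq] at key
  simpa using key

theorem exists_Lp_of_memLp_fourier {f : V → F} (hf : Integrable f) (h2 : MemLp (𝓕 f) 2 volume) :
    ∃ g : Lp F 2 (volume : Measure V), g =ᵐ[volume] f ∧
      (𝓕 g : Lp F 2 (volume : Measure V)) =ᵐ[volume] 𝓕 f := by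
  set G : Lp F 2 (volume : Measure V) := h2.toLp _
  have hG : 𝓕 (𝓕⁻ G) = G := fourier_fourierInv_eq G
  refine ⟨𝓕⁻ G, ?_, by rw [hG]; exact h2.coeFn_toLp⟩
  refine ae_eq_of_integral_fourier_schwartz_smul_eq
    ((Lp.memLp _).locallyIntegrable one_le_two) hf.locallyIntegrable fun φ => ?_
  calc ∫ x, 𝓕 φ x • (𝓕⁻ G) x = ∫ y, φ y • G y := by rw [integral_fourier_schwartz_smul, hG]
    _ = ∫ y, φ y • 𝓕 f y := by
        refine integral_congr_ae ?_
        filter_upwards [h2.coeFn_toLp] with y hy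
        rw [hy]
    _ = ∫ x, 𝓕 φ x • f x := by
        rw [SchwartzMap.fourier_coe]
        simpa using! (VectorFourier.integral_fourierIntegral_smul_eq_flip (L := innerₗ V)
          Real.continuous_fourierChar continuous_inner (φ.integrable (μ := volume)) hf).symm

end Plancherel

section FourierNormalization

theorem ae_mul_two_pi {p : ℝ → Prop} (h : ∀ᵐ ξ : ℝ, p ξ) : ∀ᵐ k : ℝ, p (k * (2 * Real.pi)) :=
  (qmp_mul (by positivity)).ae h

theorem ae_neg {p : ℝ → Prop} (h : ∀ᵐ x : ℝ, p x) : ∀ᵐ x : ℝ, p (-x) :=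
  (Measure.measurePreserving_neg (volume : Measure ℝ)).quasiMeasurePreserving.ae h

theorem memLp_comp_mul_right {E : Type*} [NormedAddCommGroup E] {f : ℝ → E} {p : ENNReal} {a : ℝ}
    (ha : a ≠ 0) (hf : MemLp f p volume) : MemLp (fun x => f (x * a)) p volume := by
  have h : MemLp f p (Measure.map (fun x : ℝ => x * a) volume) := by
    rw [Real.map_volume_mul_right ha]
    exact hf.smul_measure ENNReal.ofReal_ne_top
  exact h.comp_of_map (by fun_prop)

/-- The Plancherel transform of a complex-valued function, in the normalization of `hat`: by
definition, `hat f = hatL2 (toComplex f)`. -/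
def hatL2 (f : L2C ℝ) (ξ : ℝ) : ℂ := (𝓕 f : L2C ℝ) (ξ / (2 * Real.pi))

theorem hatL2_mul_two_pi (f : L2C ℝ) (k : ℝ) : hatL2 f (k * (2 * Real.pi)) = (𝓕 f : L2C ℝ) k := by
  rw [hatL2, mul_div_cancel_right₀ k (by positivity)]

theorem memLp_hatL2 (f : L2C ℝ) : MemLp (hatL2 f) 2 volume := by
  simpa only [hatL2, div_eq_mul_inv] using!
    memLp_comp_mul_right (a := (2 * Real.pi)⁻¹) (by positivity) (Lp.memLp (𝓕 f : L2C ℝ))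

theorem hatL2_add (f g : L2C ℝ) : hatL2 (f + g) =ᵐ[volume] fun ξ => hatL2 f ξ + hatL2 g ξ := by
  have h : (𝓕 (f + g) : L2C ℝ) = 𝓕 f + 𝓕 g := FourierTransform.fourier_add f g
  filter_upwards [ae_div_two_pi (Lp.coeFn_add (𝓕 f : L2C ℝ) (𝓕 g))] with ξ hξ
  rw [hatL2, h, hξ]
  rfl

theorem hatL2_sub (f g : L2C ℝ) : hatL2 (f - g) =ᵐ[volume] fun ξ => hatL2 f ξ - hatL2 g ξ := by
  have h : (𝓕 (f - g) : L2C ℝ) = 𝓕 f - 𝓕 g := map_sub (Lp.fourierTransformₗᵢ ℝ ℂ) f g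
  filter_upwards [ae_div_two_pi (Lp.coeFn_sub (𝓕 f : L2C ℝ) (𝓕 g))] with ξ hξ
  rw [hatL2, h, hξ]
  rfl

theorem eq_of_hatL2_ae_eq {f g : L2C ℝ} (h : hatL2 f =ᵐ[volume] hatL2 g) : f = g := by
  refine (Lp.fourierTransformₗᵢ ℝ ℂ).injective (Lp.ext ?_)
  filter_upwards [ae_mul_two_pi h] with k hk
  simpa only [hatL2_mul_two_pi] using! hk

theorem exists_hatL2_eq {F : ℝ → ℂ} (hF : MemLp F 2 volume) :
    ∃ f : L2C ℝ, hatL2 f =ᵐ[volume] F := by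
  have hm : MemLp (fun k => F (k * (2 * Real.pi))) 2 volume :=
    memLp_comp_mul_right (by positivity) hF
  refine ⟨𝓕⁻ (hm.toLp _), ?_⟩
  filter_upwards [ae_div_two_pi hm.coeFn_toLp] with ξ hξ
  rw [hatL2, fourier_fourierInv_eq, hξ, div_mul_cancel₀ ξ (by positivity)]

theorem hatL2_star (f : L2C ℝ) : hatL2 (star f) =ᵐ[volume] fun ξ => star (hatL2 f (-ξ)) := by
  filter_upwards [ae_div_two_pi (fourier_star f)] with ξ hξ
  rw [hatL2, hξ, hatL2, neg_div]

theorem coeFn_toComplex (f : Lp ℝ 2 (volume : Measure ℝ)) :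
    toComplex f =ᵐ[volume] fun x => (f x : ℂ) :=
  Complex.ofRealCLM.coeFn_compLp f

theorem star_toComplex (f : Lp ℝ 2 (volume : Measure ℝ)) : star (toComplex f) = toComplex f := by
  apply Lp.ext
  filter_upwards [Lp.coeFn_star (toComplex f), coeFn_toComplex f] with x h1 h2
  rw [h1, Pi.star_apply, h2]
  simp

theorem exists_toComplex_eq_of_star_eq {F : L2C ℝ} (hF : star F = F) :
    ∃ f : Lp ℝ 2 (volume : Measure ℝ), toComplex f = F := by
  refine ⟨Complex.reCLM.compLp F, Lp.ext ?_⟩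
  have hstar := Lp.coeFn_star F
  rw [hF] at hstar
  filter_upwards [coeFn_toComplex (Complex.reCLM.compLp F), Complex.reCLM.coeFn_compLp F, hstar]
    with x h1 h2 h3
  rw [h1, h2]
  exact Complex.conj_eq_iff_re.1 h3.symm

theorem hat_neg (f : Lp ℝ 2 (volume : Measure ℝ)) : ∀ᵐ ξ, hat f (-ξ) = star (hat f ξ) := by
  have h := hatL2_star (toComplex f)
  rw [star_toComplex] at h
  filter_upwards [h] with ξ hξ
  exact (star_star (hat f (-ξ))).symm.trans (congrArg star hξ.symm)

theorem eq_of_hat_ae_eq {f g : Lp ℝ 2 (volume : Measure ℝ)} (h : hat f =ᵐ[volume] hat g) : f = g :=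
  toComplex_injective (eq_of_hatL2_ae_eq h)

theorem exists_hat_eq {F : ℝ → ℂ} (hF : MemLp F 2 volume) (hs : ∀ᵐ ξ, F (-ξ) = star (F ξ)) :
    ∃ f : Lp ℝ 2 (volume : Measure ℝ), hat f =ᵐ[volume] F := by
  obtain ⟨G, hG⟩ := exists_hatL2_eq hF
  have hstar : star G = G := by
    refine eq_of_hatL2_ae_eq ?_
    filter_upwards [hatL2_star G, hG, ae_neg hG, hs] with ξ h1 h2 h3 h4
    rw [h1, h3, h4, star_star, h2]
  obtain ⟨f, rfl⟩ := exists_toComplex_eq_of_star_eq hstar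
  exact ⟨f, hG⟩

theorem hatL1_eq_fourier (g : ℝ → ℂ) (ξ : ℝ) : hatL1 g ξ = 𝓕 g (ξ / (2 * Real.pi)) := by
  rw [hatL1, Real.fourier_eq']
  refine integral_congr_ae (.of_forall fun x => ?_)
  simp only [smul_eq_mul]
  congr 2
  simp
  field_simp

theorem hatL1_congr_ae {f g : ℝ → ℂ} (h : f =ᵐ[volume] g) : hatL1 f = hatL1 g := by
  funext ξ
  rw [hatL1_eq_fourier, hatL1_eq_fourier, Real.fourier_congr_ae h]

theorem continuous_hatL1 {g : ℝ → ℂ} (hg : Integrable g) : Continuous (hatL1 g) := by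
  have h : hatL1 g = 𝓕 g ∘ fun ξ => ξ / (2 * Real.pi) := funext (hatL1_eq_fourier g)
  rw [h]
  exact (VectorFourier.fourierIntegral_continuous Real.continuous_fourierChar
    (L := innerₗ ℝ) continuous_inner hg).comp (by fun_prop)

theorem hatL1_mul (f g : L2C ℝ) (ξ : ℝ) :
    hatL1 (fun x => f x * g x) ξ =
      (2 * Real.pi : ℂ)⁻¹ * ∫ η, hatL2 f η * hatL2 g (ξ - η) := by
  have h := Measure.integral_comp_div
    (fun y => (𝓕 f : L2C ℝ) y * (𝓕 g : L2C ℝ) (ξ / (2 * Real.pi) - y)) (2 * Real.pi)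
  rw [abs_of_pos Real.two_pi_pos, Complex.real_smul] at h
  simp only [hatL1_eq_fourier, fourier_mul_eq_integral, hatL2, sub_div, h]
  push_cast
  rw [inv_mul_cancel_left₀ (by simp)]

theorem exists_hatL2_eq_hatL1 {f : ℝ → ℂ} (hf : Integrable f) (h2 : MemLp (hatL1 f) 2 volume) :
    ∃ g : L2C ℝ, g =ᵐ[volume] f ∧ hatL2 g =ᵐ[volume] hatL1 f := by
  have h : MemLp (𝓕 f) 2 volume := by
    simpa [hatL1_eq_fourier] using
      memLp_comp_mul_right (a := 2 * Real.pi) (by positivity) h2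
  obtain ⟨g, hgf, hg⟩ := exists_Lp_of_memLp_fourier hf h
  refine ⟨g, hgf, ?_⟩
  filter_upwards [ae_div_two_pi hg] with ξ hξ
  rw [hatL2, hξ, hatL1_eq_fourier]

theorem GevreyH.hatL2_dx {σ : ℝ} (f : GevreyH σ 2) :
    hatL2 f.dx =ᵐ[volume] fun ξ => Complex.I * ξ * hat f.toL2 ξ := by
  filter_upwards [ae_div_two_pi f.memLp_deriv.coeFn_toLp] with ξ hξ
  rw [hatL2, GevreyH.dx, fourier_fourierInv_eq, hξ, hat]
  push_cast
  field_simp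

end FourierNormalization

section LpNorm

variable {α E : Type*} [MeasurableSpace α] {μ : Measure α} [NormedAddCommGroup E]

theorem lpNorm_mono_ae_real {p : ENNReal} {f : α → E} {g : α → ℝ} (hg : MemLp g p μ)
    (h : ∀ᵐ x ∂μ, ‖f x‖ ≤ g x) : lpNorm f p μ ≤ lpNorm g p μ := by
  by_cases hf : AEStronglyMeasurable f μ
  · rw [← toReal_eLpNorm hf, ← toReal_eLpNorm hg.1]
    exact ENNReal.toReal_mono hg.2.ne (eLpNorm_mono_ae_real h)
  · simp [lpNorm_of_not_aestronglyMeasurable hf]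

theorem lpNorm_two_sq {f : α → E} (hf : AEStronglyMeasurable f μ) :
    lpNorm f 2 μ ^ 2 = ∫ x, ‖f x‖ ^ 2 ∂μ := by
  have h := lpNorm_eq_integral_norm_rpow_toReal two_ne_zero ENNReal.ofNat_ne_top hf
  simp only [ENNReal.toReal_ofNat, Real.rpow_two, ← one_div, ← Real.sqrt_eq_rpow] at h
  rw [h, Real.sq_sqrt (integral_nonneg fun x => sq_nonneg _)]

end LpNorm

section Weight

theorem bracket_sq (ξ : ℝ) : bracket ξ ^ 2 = 1 + ξ ^ 2 := Real.sq_sqrt (by positivity)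

theorem one_le_bracket (ξ : ℝ) : 1 ≤ bracket ξ := Real.one_le_sqrt.2 (by nlinarith [sq_nonneg ξ])

theorem continuous_bracket : Continuous bracket := by
  unfold bracket
  fun_prop

theorem one_le_weight {s : ℝ} (hs : 0 ≤ s) (σ ξ : ℝ) : 1 ≤ weight σ s ξ :=
  one_le_mul_of_one_le_of_one_le (Real.one_le_cosh _) (Real.one_le_rpow (one_le_bracket ξ) hs)

theorem weight_neg (σ s ξ : ℝ) : weight σ s (-ξ) = weight σ s ξ := by
  simp [weight, bracket]

theorem norm_weight (σ s ξ : ℝ) : ‖(weight σ s ξ : ℂ)‖ = weight σ s ξ := by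
  rw [Complex.norm_real, Real.norm_of_nonneg (weight_pos σ s ξ).le]

theorem continuous_weight (σ s : ℝ) : Continuous (weight σ s) :=
  (by fun_prop : Continuous fun ξ : ℝ => Real.cosh (σ * |ξ|)).mul
    (continuous_bracket.rpow_const fun ξ => Or.inl (bracket_pos ξ).ne')

end Weight

namespace GevreyH

variable {σ s : ℝ}

theorem hat_toL2_add (f g : GevreyH σ s) :
    hat (f + g).toL2 =ᵐ[volume] fun ξ => hat f.toL2 ξ + hat g.toL2 ξ :=
  hat_add f.toL2 g.toL2

theorem hat_toL2_smul (c : ℝ) (f : GevreyH σ s) :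
    hat (c • f).toL2 =ᵐ[volume] fun ξ => c * hat f.toL2 ξ :=
  hat_smul c f.toL2

theorem hat_toL2_sub (f g : GevreyH σ s) :
    hat (f - g).toL2 =ᵐ[volume] fun ξ => hat f.toL2 ξ - hat g.toL2 ξ := by
  rw [sub_eq_add_neg, ← neg_one_smul ℝ g]
  filter_upwards [hat_toL2_add f ((-1 : ℝ) • g), hat_toL2_smul (-1) g] with ξ h1 h2
  rw [h1, h2]
  push_cast
  ring

theorem ext_hat {f g : GevreyH σ s} (h : hat f.toL2 =ᵐ[volume] hat g.toL2) : f = g :=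
  Subtype.ext (eq_of_hat_ae_eq h)

theorem exists_of_weighted (hs : 0 ≤ s) {W : ℝ → ℂ} (hW : MemLp W 2 volume)
    (hW_neg : ∀ᵐ ξ, W (-ξ) = star (W ξ)) :
    ∃ f : GevreyH σ s, weightedHat σ s f.toL2 =ᵐ[volume] W := by
  have hV : MemLp (fun ξ => ((weight σ s ξ)⁻¹ : ℝ) * W ξ) 2 volume := by
    refine hW.of_le (AEStronglyMeasurable.mul ?_ hW.1) (.of_forall fun ξ => ?_)
    · exact (Complex.continuous_ofReal.comp
        ((continuous_weight σ s).inv₀ fun ξ => (weight_pos σ s ξ).ne')).aestronglyMeasurable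
    · rw [norm_mul, Complex.norm_real, Real.norm_of_nonneg (inv_nonneg.2 (weight_pos σ s ξ).le)]
      exact mul_le_of_le_one_left (norm_nonneg _) (inv_le_one_of_one_le₀ (one_le_weight hs σ ξ))
  obtain ⟨f, hf⟩ := exists_hat_eq hV (by
    filter_upwards [hW_neg] with ξ h
    simp [weight_neg, h])
  have hw : weightedHat σ s f =ᵐ[volume] W := by
    filter_upwards [hf] with ξ h
    rw [weightedHat, h, ← mul_assoc, ← Complex.ofReal_mul, mul_inv_cancel₀ (weight_pos σ s ξ).ne',
      Complex.ofReal_one, one_mul]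
  exact ⟨⟨f, (memLp_congr_ae hw).2 hW⟩, hw⟩

theorem exists_of_hat (hs : 0 ≤ s) {V : ℝ → ℂ}
    (hV : MemLp (fun ξ => (weight σ s ξ : ℂ) * V ξ) 2 volume)
    (hV_neg : ∀ᵐ ξ, V (-ξ) = star (V ξ)) :
    ∃ f : GevreyH σ s, hat f.toL2 =ᵐ[volume] V := by
  obtain ⟨f, hf⟩ := exists_of_weighted hs hV (by
    filter_upwards [hV_neg] with ξ h
    simp [weight_neg, h])
  refine ⟨f, ?_⟩
  filter_upwards [hf] with ξ h
  exact mul_left_cancel₀ (by exact_mod_cast (weight_pos σ s ξ).ne') h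

theorem coeFn_weighted (f : GevreyH σ s) : weighted σ s f =ᵐ[volume] weightedHat σ s f.toL2 :=
  f.memLp.coeFn_toLp

theorem norm_eq_lpNorm (f : GevreyH σ s) : ‖f‖ = lpNorm (weightedHat σ s f.toL2) 2 volume := by
  rw [← toReal_eLpNorm f.memLp.1]
  exact f.norm_eq

theorem norm_le_of_ae_le (f : GevreyH σ s) {b : ℝ → ℝ} (hb : MemLp b 2 volume)
    (h : ∀ᵐ ξ, weight σ s ξ * ‖hat f.toL2 ξ‖ ≤ b ξ) : ‖f‖ ≤ lpNorm b 2 volume := by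
  rw [norm_eq_lpNorm]
  refine lpNorm_mono_ae_real hb ?_
  filter_upwards [h] with ξ hξ
  rwa [weightedHat, norm_mul, norm_weight]

theorem isometry_weighted (σ s : ℝ) : Isometry (weighted σ s) :=
  AddMonoidHomClass.isometry_of_norm _ fun _ => rfl

theorem range_weighted (hs : 0 ≤ s) :
    range (weighted σ s) = {W : L2C ℝ | ∀ᵐ ξ, W (-ξ) = star (W ξ)} := by
  ext W
  constructor
  · rintro ⟨f, rfl⟩
    filter_upwards [coeFn_weighted f, ae_neg (coeFn_weighted f), hat_neg f.toL2] with ξ h1 h2 h3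
    rw [h1, h2]
    simp [weightedHat, weight_neg, h3]
  · intro h
    obtain ⟨f, hf⟩ := exists_of_weighted (σ := σ) hs (Lp.memLp W) h
    exact ⟨f, Lp.ext ((coeFn_weighted f).trans hf)⟩

theorem isClosed_setOf_hermitian : IsClosed {W : L2C ℝ | ∀ᵐ ξ, W (-ξ) = star (W ξ)} := by
  have hmp := Measure.measurePreserving_neg (volume : Measure ℝ)
  let conj : L2C ℝ →L[ℝ] L2C ℝ := Complex.conjCLE.toContinuousLinearMap.compLpL 2 volume
  have h : {W : L2C ℝ | ∀ᵐ ξ, W (-ξ) = star (W ξ)} =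
      {W : L2C ℝ | Lp.compMeasurePreserving Neg.neg hmp W = conj W} := by
    ext W
    have h1 := Lp.coeFn_compMeasurePreserving W hmp
    have h2 : conj W =ᵐ[volume] fun ξ => star (W ξ) :=
      Complex.conjCLE.toContinuousLinearMap.coeFn_compLp W
    rw [mem_ofPred_eq, mem_ofPred_eq, Lp.ext_iff]
    exact ⟨fun hW => h1.trans (.trans hW h2.symm), fun hW => h1.symm.trans (hW.trans h2)⟩
  rw [h]
  exact isClosed_eq (Lp.isometry_compMeasurePreserving hmp).continuous conj.continuous

theorem completeSpace (hs : 0 ≤ s) : CompleteSpace (GevreyH σ s) := by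
  rw [completeSpace_iff_isComplete_range (isometry_weighted σ s).isUniformInducing,
    range_weighted hs]
  exact isClosed_setOf_hermitian.isComplete

instance : CompleteSpace (GevreyH σ 2) := completeSpace zero_le_two

end GevreyH

section Propagator

theorem Coeffs.denom_neg (p : Coeffs) (ξ : ℝ) : p.denom (-ξ) = p.denom ξ := by
  simp only [Coeffs.denom]
  ring

theorem Coeffs.phi_neg (p : Coeffs) (ξ : ℝ) : p.phi (-ξ) = -p.phi ξ := by
  simp only [Coeffs.phi, p.denom_neg]
  ring

theorem Coeffs.measurable_phi (p : Coeffs) : Measurable p.phi := by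
  unfold Coeffs.phi Coeffs.denom
  fun_prop

theorem norm_phase (t x : ℝ) : ‖Complex.exp (-Complex.I * t * x)‖ = 1 := by
  simp [Complex.norm_exp]

namespace GevreyH

variable {σ s : ℝ}

theorem exists_evolve (p : Coeffs) (t : ℝ) (u : GevreyH σ s) :
    ∃ g : GevreyH σ s,
      hat g.toL2 =ᵐ[volume] fun ξ => Complex.exp (-Complex.I * t * p.phi ξ) * hat u.toL2 ξ := by
  have hm : Measurable fun ξ => Complex.exp (-Complex.I * t * p.phi ξ) := by
    have := p.measurable_phi
    fun_prop
  have hu : MemLp (hat u.toL2) 2 volume := memLp_hatL2 (toComplex u.toL2)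
  obtain ⟨g, hg⟩ := exists_hat_eq
    (hu.of_le (hm.aestronglyMeasurable.mul hu.1) (.of_forall fun ξ => by
      rw [Pi.mul_apply, norm_mul, norm_phase, one_mul])) (by
    filter_upwards [hat_neg u.toL2] with ξ h
    simp [h, p.phi_neg, ← Complex.exp_conj])
  have hw : (fun ξ => Complex.exp (-Complex.I * t * p.phi ξ) * weightedHat σ s u.toL2 ξ)
      =ᵐ[volume] weightedHat σ s g := by
    filter_upwards [hg] with ξ h
    rw [weightedHat, weightedHat, h, Pi.mul_apply, mul_left_comm]
  refine ⟨⟨g, u.memLp.of_le ((hm.aestronglyMeasurable.mul u.memLp.1).congr hw) ?_⟩, hg⟩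
  filter_upwards [hw] with ξ h
  rw [← h, norm_mul, norm_phase, one_mul]

/-- The propagator `e^{-itφ(D)}` of the linearized equation, a linear isometry of `H^{σ,s}(ℝ)`. -/
def evolve (p : Coeffs) (t : ℝ) : GevreyH σ s →ₗᵢ[ℝ] GevreyH σ s where
  toFun u := (exists_evolve p t u).choose
  map_add' u v := by
    refine ext_hat ?_
    filter_upwards [(exists_evolve p t (u + v)).choose_spec, hat_toL2_add u v,
      (exists_evolve p t u).choose_spec, (exists_evolve p t v).choose_spec,
      hat_toL2_add (exists_evolve p t u).choose (exists_evolve p t v).choose] with ξ h1 h2 h3 h4 h5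
    rw [h1, h2, h5, h3, h4, mul_add]
  map_smul' c u := by
    refine ext_hat ?_
    filter_upwards [(exists_evolve p t (c • u)).choose_spec, hat_toL2_smul c u,
      (exists_evolve p t u).choose_spec, hat_toL2_smul c (exists_evolve p t u).choose]
      with ξ h1 h2 h3 h4
    rw [h1, h2, RingHom.id_apply, h4, h3, mul_left_comm]
  norm_map' u := by
    change ‖(exists_evolve p t u).choose‖ = ‖u‖
    rw [norm_eq, norm_eq]
    refine congrArg ENNReal.toReal (eLpNorm_congr_norm_ae ?_)
    filter_upwards [(exists_evolve p t u).choose_spec] with ξ h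
    rw [h, norm_mul, norm_mul, norm_mul, norm_phase, one_mul]

theorem hat_evolve (p : Coeffs) (t : ℝ) (u : GevreyH σ s) :
    hat (evolve p t u).toL2 =ᵐ[volume]
      fun ξ => Complex.exp (-Complex.I * t * p.phi ξ) * hat u.toL2 ξ :=
  (exists_evolve p t u).choose_spec

theorem evolve_zero (p : Coeffs) (u : GevreyH σ s) : evolve p 0 u = u := by
  refine ext_hat ?_
  filter_upwards [hat_evolve p 0 u] with ξ h
  simp [h]

theorem evolve_add (p : Coeffs) (t r : ℝ) (u : GevreyH σ s) :
    evolve p (t + r) u = evolve p t (evolve p r u) := by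
  refine ext_hat ?_
  filter_upwards [hat_evolve p t (evolve p r u), hat_evolve p r u, hat_evolve p (t + r) u]
    with ξ h1 h2 h3
  rw [h1, h2, h3, ← mul_assoc, ← Complex.exp_add]
  congr 2
  push_cast
  ring

theorem sq_norm_evolve_sub_evolve (p : Coeffs) (t r : ℝ) (u : GevreyH σ s) :
    ‖evolve p t u - evolve p r u‖ ^ 2 =
      ∫ ξ, ‖(Complex.exp (-Complex.I * t * p.phi ξ) - Complex.exp (-Complex.I * r * p.phi ξ)) *
        weightedHat σ s u.toL2 ξ‖ ^ 2 := by
  rw [norm_eq_lpNorm, lpNorm_two_sq (evolve p t u - evolve p r u).memLp.1]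
  refine integral_congr_ae ?_
  filter_upwards [hat_toL2_sub (evolve p t u) (evolve p r u), hat_evolve p t u, hat_evolve p r u]
    with ξ h1 h2 h3
  rw [weightedHat, h1, h2, h3, weightedHat, ← sub_mul, mul_left_comm]

theorem continuous_evolve_apply (p : Coeffs) (u : GevreyH σ s) :
    Continuous fun t => evolve p t u := by
  refine continuous_iff_continuousAt.2 fun r => tendsto_iff_norm_sub_tendsto_zero.2 ?_
  have hcont : Continuous fun t : ℝ => ∫ ξ, ‖(Complex.exp (-Complex.I * t * p.phi ξ) -
      Complex.exp (-Complex.I * r * p.phi ξ)) * weightedHat σ s u.toL2 ξ‖ ^ 2 := by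
    refine continuous_of_dominated (bound := fun ξ => (2 * ‖weightedHat σ s u.toL2 ξ‖) ^ 2)
      (fun t => ?_) (fun t => .of_forall fun ξ => ?_) ?_ (.of_forall fun ξ => by fun_prop)
    · have hm : Measurable fun ξ => Complex.exp (-Complex.I * t * p.phi ξ) -
          Complex.exp (-Complex.I * r * p.phi ξ) := by
        have := p.measurable_phi
        fun_prop
      exact (hm.aestronglyMeasurable.mul u.memLp.1).norm.pow 2
    · rw [norm_mul, Real.norm_of_nonneg (by positivity)]
      gcongr
      refine (norm_sub_le _ _).trans_eq ?_
      rw [norm_phase, norm_phase, one_add_one_eq_two]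
    · simp only [mul_pow]
      exact ((memLp_two_iff_integrable_sq_norm u.memLp.1).1 u.memLp).const_mul _
  have hsq : Filter.Tendsto (fun t => ‖evolve p t u - evolve p r u‖ ^ 2) (nhds r) (nhds 0) := by
    simpa [sq_norm_evolve_sub_evolve] using hcont.tendsto r
  simpa [Real.sqrt_sq (norm_nonneg _)] using hsq.sqrt

end GevreyH

end Propagator

section Product

theorem integral_norm_mul_norm_le_lpNorm_mul_lpNorm {α E : Type*} [MeasurableSpace α]
    {μ : Measure α} [NormedAddCommGroup E] {f g : α → E}
    (hf : MemLp f 2 μ) (hg : MemLp g 2 μ) :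
    ∫ x, ‖f x‖ * ‖g x‖ ∂μ ≤ lpNorm f 2 μ * lpNorm g 2 μ := by
  rw [lpNorm_eq_integral_norm_rpow_toReal two_ne_zero ENNReal.ofNat_ne_top hf.1,
    lpNorm_eq_integral_norm_rpow_toReal two_ne_zero ENNReal.ofNat_ne_top hg.1]
  simpa using integral_mul_norm_le_Lp_mul_Lq Real.HolderConjugate.two_two
    (by simpa using hf) (by simpa using hg)

theorem lpNorm_comp_measurePreserving {α β E : Type*} [MeasurableSpace α] [MeasurableSpace β]
    {μ : Measure α} {ν : Measure β} [NormedAddCommGroup E] {g : β → E} {f : α → β} {p : ENNReal}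
    (hg : AEStronglyMeasurable g ν) (hf : MeasurePreserving f μ ν) :
    lpNorm (g ∘ f) p μ = lpNorm g p ν := by
  rw [← toReal_eLpNorm hg, ← toReal_eLpNorm (hg.comp_measurePreserving hf),
    eLpNorm_comp_measurePreserving hg hf]

theorem mul_norm_integral_mul_comp_sub_le {w : ℝ → ℝ} (hw : ∀ ξ, 0 < w ξ) {C : ℝ}
    (hC : ∀ a b, w (a + b) ≤ C * (w a * w b)) {f g : ℝ → ℂ}
    (hf : MemLp (fun ξ => (w ξ : ℂ) * f ξ) 2 volume)
    (hg : MemLp (fun ξ => (w ξ : ℂ) * g ξ) 2 volume) (ξ : ℝ) :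
    w ξ * ‖∫ η, f η * g (ξ - η)‖ ≤
      C * (lpNorm (fun ξ => (w ξ : ℂ) * f ξ) 2 volume *
        lpNorm (fun ξ => (w ξ : ℂ) * g ξ) 2 volume) := by
  have hC0 : 0 ≤ C := nonneg_of_mul_nonneg_left ((hw _).le.trans (hC 0 0)) (mul_pos (hw 0) (hw 0))
  have hmp := Measure.measurePreserving_sub_left (volume : Measure ℝ) ξ
  have hg' := hg.comp_measurePreserving hmp
  have hpt (η : ℝ) : ‖(w ξ : ℂ) * (f η * g (ξ - η))‖ ≤
      C * (‖(w η : ℂ) * f η‖ * ‖(w (ξ - η) : ℂ) * g (ξ - η)‖) := by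
    simp only [norm_mul, Complex.norm_real, Real.norm_of_nonneg (hw _).le]
    have h := hC η (ξ - η)
    rw [add_sub_cancel] at h
    calc w ξ * (‖f η‖ * ‖g (ξ - η)‖)
        ≤ C * (w η * w (ξ - η)) * (‖f η‖ * ‖g (ξ - η)‖) := by gcongr
      _ = _ := by ring
  calc w ξ * ‖∫ η, f η * g (ξ - η)‖ = ‖∫ η, (w ξ : ℂ) * (f η * g (ξ - η))‖ := by
        rw [integral_const_mul, norm_mul, Complex.norm_real, Real.norm_of_nonneg (hw ξ).le]
    _ ≤ ∫ η, C * (‖(w η : ℂ) * f η‖ * ‖(w (ξ - η) : ℂ) * g (ξ - η)‖) :=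
        norm_integral_le_of_norm_le ((hf.norm.integrable_mul hg'.norm).const_mul C)
          (.of_forall hpt)
    _ ≤ _ := by
        rw [integral_const_mul]
        gcongr
        refine (integral_norm_mul_norm_le_lpNorm_mul_lpNorm hf hg').trans_eq ?_
        rw [lpNorm_comp_measurePreserving hg.1 hmp]

theorem cosh_mul_abs_add_le (σ a b : ℝ) :
    Real.cosh (σ * |a + b|) ≤ 2 * (Real.cosh (σ * |a|) * Real.cosh (σ * |b|)) := by
  have h (x : ℝ) : Real.cosh (σ * |x|) = Real.cosh (σ * x) := by
    rw [← Real.cosh_abs, abs_mul, abs_abs, ← abs_mul, Real.cosh_abs]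
  rw [h, h, h, mul_add, Real.cosh_add]
  linarith [Real.cosh_pos (σ * a - σ * b), Real.cosh_sub (σ * a) (σ * b)]

theorem bracket_add_le (a b : ℝ) : bracket (a + b) ≤ √2 * (bracket a * bracket b) := by
  unfold bracket
  rw [← Real.sqrt_mul (by positivity), ← Real.sqrt_mul zero_le_two]
  exact Real.sqrt_le_sqrt (by nlinarith [sq_nonneg (a - b), sq_nonneg (a * b)])

theorem weight_add_le {s : ℝ} (hs : 0 ≤ s) (σ a b : ℝ) :
    weight σ s (a + b) ≤ 2 * √2 ^ s * (weight σ s a * weight σ s b) := by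
  have ha := bracket_pos a
  have hb := bracket_pos b
  have h : bracket (a + b) ^ s ≤ √2 ^ s * (bracket a ^ s * bracket b ^ s) := by
    rw [← Real.mul_rpow ha.le hb.le, ← Real.mul_rpow (by positivity) (by positivity)]
    exact Real.rpow_le_rpow (bracket_pos _).le (bracket_add_le a b) hs
  calc weight σ s (a + b)
      ≤ 2 * (Real.cosh (σ * |a|) * Real.cosh (σ * |b|)) *
          (√2 ^ s * (bracket a ^ s * bracket b ^ s)) := by
        have := bracket_pos (a + b)
        unfold weight
        gcongr
        exact cosh_mul_abs_add_le σ a b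
    _ = _ := by
        unfold weight
        ring

theorem weight_mono {s s' : ℝ} (h : s ≤ s') (σ ξ : ℝ) : weight σ s ξ ≤ weight σ s' ξ :=
  mul_le_mul_of_nonneg_left (Real.rpow_le_rpow_of_exponent_le (one_le_bracket ξ) h)
    (Real.cosh_pos _).le

theorem weight_one_mul_bracket (σ ξ : ℝ) : weight σ 1 ξ * bracket ξ = weight σ 2 ξ := by
  rw [weight, Real.rpow_one, mul_assoc, ← sq, ← Real.rpow_two, ← weight]

/-- Membership of a complex-valued function in the modified Gevrey space of order `s`; for
real-valued functions this is membership in `gevreySubmodule σ s`. -/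
def MemGevrey (σ s : ℝ) (f : L2C ℝ) : Prop :=
  MemLp (fun ξ => (weight σ s ξ : ℂ) * hatL2 f ξ) 2 volume

/-- The norm of the modified Gevrey space for complex-valued functions; it agrees with the norm of
`GevreyH σ s` on real-valued functions. -/
def gevreyNorm (σ s : ℝ) (f : L2C ℝ) : ℝ :=
  lpNorm (fun ξ => (weight σ s ξ : ℂ) * hatL2 f ξ) 2 volume

variable {σ s s' : ℝ} {f g h : L2C ℝ}

theorem gevreyNorm_nonneg (σ s : ℝ) (f : L2C ℝ) : 0 ≤ gevreyNorm σ s f := lpNorm_nonneg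

theorem memGevrey_and_gevreyNorm_le_of_ae_le {b : ℝ → ℝ} (hb : MemLp b 2 volume)
    (h : ∀ᵐ ξ, weight σ s ξ * ‖hatL2 f ξ‖ ≤ b ξ) :
    MemGevrey σ s f ∧ gevreyNorm σ s f ≤ lpNorm b 2 volume := by
  have hle : ∀ᵐ ξ, ‖(weight σ s ξ : ℂ) * hatL2 f ξ‖ ≤ b ξ := by
    simpa only [norm_mul, norm_weight] using h
  have hc : Continuous fun ξ => (weight σ s ξ : ℂ) :=
    Complex.continuous_ofReal.comp (continuous_weight σ s)
  refine ⟨hb.mono' (hc.aestronglyMeasurable.mul (memLp_hatL2 f).1) hle, ?_⟩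
  exact lpNorm_mono_ae_real hb hle

theorem MemGevrey.of_ae_le (hf : MemGevrey σ s f)
    (h : ∀ᵐ ξ, weight σ s' ξ * ‖hatL2 g ξ‖ ≤ weight σ s ξ * ‖hatL2 f ξ‖) :
    MemGevrey σ s' g ∧ gevreyNorm σ s' g ≤ gevreyNorm σ s f := by
  have h1 := memGevrey_and_gevreyNorm_le_of_ae_le (f := g) (s := s') hf.norm
    (h.mono fun ξ hξ => by rwa [norm_mul, norm_weight])
  rwa [lpNorm_norm hf.1] at h1

theorem MemGevrey.mono (hf : MemGevrey σ s' f) (hs : s ≤ s') :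
    MemGevrey σ s f ∧ gevreyNorm σ s f ≤ gevreyNorm σ s' f :=
  hf.of_ae_le (.of_forall fun ξ =>
    mul_le_mul_of_nonneg_right (weight_mono hs σ ξ) (norm_nonneg _))

theorem GevreyH.memGevrey_toComplex (u : GevreyH σ s) : MemGevrey σ s (toComplex u.toL2) := u.memLp

theorem GevreyH.gevreyNorm_toComplex (u : GevreyH σ s) : gevreyNorm σ s (toComplex u.toL2) = ‖u‖ :=
  u.norm_eq_lpNorm.symm

theorem GevreyH.memGevrey_dx (u : GevreyH σ 2) :
    MemGevrey σ 1 u.dx ∧ gevreyNorm σ 1 u.dx ≤ ‖u‖ := by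
  rw [← u.gevreyNorm_toComplex]
  refine u.memGevrey_toComplex.of_ae_le ?_
  filter_upwards [u.hatL2_dx] with ξ hξ
  have h1 : |ξ| ≤ bracket ξ := Real.abs_le_sqrt (by linarith)
  have h2 := weight_pos σ 1 ξ
  calc weight σ 1 ξ * ‖hatL2 u.dx ξ‖ = weight σ 1 ξ * |ξ| * ‖hat u.toL2 ξ‖ := by
        simp [hξ, mul_assoc]
    _ ≤ weight σ 1 ξ * bracket ξ * ‖hat u.toL2 ξ‖ := by gcongr
    _ = weight σ 2 ξ * ‖hatL2 (toComplex u.toL2) ξ‖ := by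
        rw [weight_one_mul_bracket]
        rfl

theorem weight_mul_norm_hatL1_mul_le (hs : 0 ≤ s) (hs2 : s ≤ 2) (hf : MemGevrey σ s f)
    (hg : MemGevrey σ s g) (ξ : ℝ) :
    weight σ s ξ * ‖hatL1 (fun x => f x * g x) ξ‖ ≤ gevreyNorm σ s f * gevreyNorm σ s g := by
  have h := mul_norm_integral_mul_comp_sub_le (weight_pos σ s) (weight_add_le hs σ) hf hg ξ
  have hC : 2 * √2 ^ s ≤ 2 * Real.pi := by
    have h1 : √2 ^ s ≤ √2 ^ (2 : ℝ) :=
      Real.rpow_le_rpow_of_exponent_le (Real.one_le_sqrt.2 one_le_two) hs2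
    rw [Real.rpow_two, Real.sq_sqrt zero_le_two] at h1
    linarith [Real.pi_gt_three]
  have hN := mul_nonneg (gevreyNorm_nonneg σ s f) (gevreyNorm_nonneg σ s g)
  rw [hatL1_mul, norm_mul, mul_left_comm, norm_inv, norm_mul, Complex.norm_ofNat,
    Complex.norm_of_nonneg Real.pi_pos.le, inv_mul_le_iff₀ Real.two_pi_pos]
  exact h.trans (mul_le_mul_of_nonneg_right hC hN)

theorem memLp_inv_bracket : MemLp (fun ξ => (bracket ξ)⁻¹) 2 volume := by
  have hc : Continuous fun ξ => (bracket ξ)⁻¹ :=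
    continuous_bracket.inv₀ fun ξ => (bracket_pos ξ).ne'
  rw [memLp_two_iff_integrable_sq hc.aestronglyMeasurable]
  simpa only [inv_pow, bracket_sq] using integrable_inv_one_add_sq

theorem lpNorm_inv_bracket : lpNorm (fun ξ => (bracket ξ)⁻¹) 2 volume = √Real.pi := by
  rw [← Real.sqrt_sq (lpNorm_nonneg (f := fun ξ => (bracket ξ)⁻¹)),
    lpNorm_two_sq memLp_inv_bracket.1]
  simp only [norm_inv, Real.norm_of_nonneg (bracket_pos _).le, inv_pow, bracket_sq,
    integral_univ_inv_one_add_sq]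

theorem memLp_mul_inv_bracket (C : ℝ) :
    MemLp (fun ξ => C * (bracket ξ)⁻¹) 2 volume :=
  memLp_inv_bracket.const_mul C

theorem lpNorm_mul_inv_bracket {C : ℝ} (hC : 0 ≤ C) :
    lpNorm (fun ξ => C * (bracket ξ)⁻¹) 2 volume = √Real.pi * C := by
  have h := lpNorm_const_smul C (fun ξ => (bracket ξ)⁻¹) (volume : Measure ℝ) (p := 2)
  rw [lpNorm_inv_bracket, coe_nnnorm, Real.norm_of_nonneg hC] at h
  rw [mul_comm, ← h]
  rfl

theorem integrable_mul (f g : L2C ℝ) : Integrable fun x => f x * g x :=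
  (Lp.memLp f).integrable_mul (Lp.memLp g)

theorem MemGevrey.exists_mul (hf : MemGevrey σ 2 f) (hg : MemGevrey σ 2 g) :
    ∃ h : L2C ℝ, h =ᵐ[volume] (fun x => f x * g x) ∧ MemGevrey σ 1 h ∧
      gevreyNorm σ 1 h ≤ √Real.pi * (gevreyNorm σ 2 f * gevreyNorm σ 2 g) := by
  set C := gevreyNorm σ 2 f * gevreyNorm σ 2 g
  have hC : 0 ≤ C := mul_nonneg (gevreyNorm_nonneg σ 2 f) (gevreyNorm_nonneg σ 2 g)
  have hb := memLp_mul_inv_bracket C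
  have hle (ξ : ℝ) : weight σ 1 ξ * ‖hatL1 (fun x => f x * g x) ξ‖ ≤ C * (bracket ξ)⁻¹ := by
    have h := weight_mul_norm_hatL1_mul_le zero_le_two le_rfl hf hg ξ
    rw [← weight_one_mul_bracket, mul_right_comm] at h
    exact (le_mul_inv_iff₀ (bracket_pos ξ)).2 h
  have h2 : MemLp (hatL1 fun x => f x * g x) 2 volume :=
    hb.mono' (continuous_hatL1 (integrable_mul f g)).aestronglyMeasurable (.of_forall fun ξ =>
      (le_mul_of_one_le_left (norm_nonneg _) (one_le_weight zero_le_one σ ξ)).trans (hle ξ))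
  obtain ⟨h, hh, hhat⟩ := exists_hatL2_eq_hatL1 (integrable_mul f g) h2
  refine ⟨h, hh, ?_⟩
  rw [← lpNorm_mul_inv_bracket hC]
  refine memGevrey_and_gevreyNorm_le_of_ae_le hb ?_
  filter_upwards [hhat] with ξ hξ
  rw [hξ]
  exact hle ξ

theorem weight_mul_norm_hatL1_mul_mul_le (hf : MemGevrey σ 2 f) (hg : MemGevrey σ 2 g)
    (hh : MemGevrey σ 2 h) (ξ : ℝ) :
    weight σ 1 ξ * ‖hatL1 (fun x => f x * g x * h x) ξ‖ ≤
      √Real.pi * (gevreyNorm σ 2 f * gevreyNorm σ 2 g * gevreyNorm σ 2 h) := by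
  obtain ⟨k, hk, hmem, hnorm⟩ := hf.exists_mul hg
  obtain ⟨hmem', hnorm'⟩ := hh.mono one_le_two
  have hcongr : (fun x => f x * g x * h x) =ᵐ[volume] fun x => k x * h x := by
    filter_upwards [hk] with x hx
    rw [hx]
  rw [hatL1_congr_ae hcongr]
  refine (weight_mul_norm_hatL1_mul_le zero_le_one one_le_two hmem hmem' ξ).trans ?_
  rw [← mul_assoc]
  exact mul_le_mul hnorm hnorm' (gevreyNorm_nonneg σ 1 h) ((gevreyNorm_nonneg σ 1 k).trans hnorm)

theorem MemGevrey.integrable_mul_mul (hf : MemGevrey σ 2 f) (hg : MemGevrey σ 2 g) (h : L2C ℝ) :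
    Integrable fun x => f x * g x * h x := by
  obtain ⟨k, hk, -⟩ := hf.exists_mul hg
  refine (integrable_mul k h).congr ?_
  filter_upwards [hk] with x hx
  rw [hx]

end Product

section Symbols

namespace Coeffs

theorem psi_neg (p : Coeffs) (ξ : ℝ) : p.psi (-ξ) = -p.psi ξ := by
  rw [psi, psi, p.denom_neg, neg_div]

theorem tau_eq_mul_psi (p : Coeffs) (ξ : ℝ) :
    p.tau ξ = (3 - 4 * p.γ * ξ ^ 2) / 4 * p.psi ξ := by
  rw [tau, psi, div_mul_div_comm, mul_comm ξ]

theorem tau_neg (p : Coeffs) (ξ : ℝ) : p.tau (-ξ) = -p.tau ξ := by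
  rw [tau_eq_mul_psi, tau_eq_mul_psi, psi_neg, neg_sq, mul_neg]

theorem measurable_psi (p : Coeffs) : Measurable p.psi := by
  unfold psi denom
  fun_prop

theorem measurable_tau (p : Coeffs) : Measurable p.tau := by
  unfold tau denom
  fun_prop

/-- Ellipticity of the operator `1 - γ₁∂ₓ² + δ₁∂ₓ⁴`, with constant `C`: its symbol dominates
`C⁻¹⟨ξ⟩⁴`. Evaluating at `ξ = 0` shows that such a `C` is positive. -/
def IsEllipticWith (p : Coeffs) (C : ℝ) : Prop :=
  ∀ ξ : ℝ, bracket ξ ^ 4 ≤ C * p.denom ξ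

namespace IsEllipticWith

variable {p : Coeffs} {C : ℝ}

theorem pos (hp : p.IsEllipticWith C) : 0 < C := by
  have h := hp 0
  rw [denom] at h
  have := pow_pos (bracket_pos 0) 4
  linarith

theorem denom_pos (hp : p.IsEllipticWith C) (ξ : ℝ) : 0 < p.denom ξ :=
  pos_of_mul_pos_right ((pow_pos (bracket_pos ξ) 4).trans_le (hp ξ)) hp.pos.le

theorem bracket_sq_mul_abs_psi_le (hp : p.IsEllipticWith C) (ξ : ℝ) :
    bracket ξ ^ 2 * |p.psi ξ| ≤ C * (bracket ξ)⁻¹ := by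
  have hd := hp.denom_pos ξ
  have hb := bracket_pos ξ
  rw [psi, abs_div, abs_of_pos hd, ← div_eq_mul_inv, le_div_iff₀ hb, ← mul_div_assoc,
    div_mul_eq_mul_div, div_le_iff₀ hd]
  refine le_trans ?_ (hp ξ)
  calc bracket ξ ^ 2 * |ξ| * bracket ξ ≤ bracket ξ ^ 2 * bracket ξ * bracket ξ := by
        gcongr
        exact Real.abs_le_sqrt (by linarith)
    _ = bracket ξ ^ 4 := by ring

theorem bracket_mul_abs_psi_le (hp : p.IsEllipticWith C) (ξ : ℝ) :
    bracket ξ * |p.psi ξ| ≤ C * (bracket ξ)⁻¹ := by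
  refine le_trans ?_ (hp.bracket_sq_mul_abs_psi_le ξ)
  gcongr
  exact le_self_pow₀ (one_le_bracket ξ) two_ne_zero

theorem abs_tau_le (hp : p.IsEllipticWith C) (ξ : ℝ) :
    |p.tau ξ| ≤ (1 + |p.γ|) * (C * (bracket ξ)⁻¹) := by
  have h : |(3 - 4 * p.γ * ξ ^ 2) / 4| ≤ (1 + |p.γ|) * bracket ξ ^ 2 := by
    have hγ : |p.γ * ξ ^ 2| = |p.γ| * ξ ^ 2 := by rw [abs_mul, abs_of_nonneg (sq_nonneg ξ)]
    rw [bracket_sq, abs_le]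
    constructor <;>
      nlinarith [neg_abs_le (p.γ * ξ ^ 2), le_abs_self (p.γ * ξ ^ 2), sq_nonneg ξ,
        abs_nonneg p.γ]
  calc |p.tau ξ| = |(3 - 4 * p.γ * ξ ^ 2) / 4| * |p.psi ξ| := by rw [tau_eq_mul_psi, abs_mul]
    _ ≤ (1 + |p.γ|) * bracket ξ ^ 2 * |p.psi ξ| := by gcongr
    _ ≤ _ := by
        rw [mul_assoc]
        exact mul_le_mul_of_nonneg_left (hp.bracket_sq_mul_abs_psi_le ξ) (by positivity)

end IsEllipticWith

-- The condition on `γ₁` is sharp: it says that `1 + γ₁x + δ₁x²` has no root `x ≥ 0`.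
theorem exists_isEllipticWith (p : Coeffs) (hγ₁ : -2 * √p.δ₁ < p.γ₁) (hδ₁ : 0 < p.δ₁) :
    ∃ C, p.IsEllipticWith C := by
  obtain ⟨d, hd⟩ : ∃ d, √p.δ₁ = d := ⟨_, rfl⟩
  have hd0 : 0 < d := hd ▸ Real.sqrt_pos.2 hδ₁
  have hdsq : p.δ₁ = d ^ 2 := by rw [← hd, Real.sq_sqrt hδ₁.le]
  rw [hd] at hγ₁
  obtain ⟨θ, hθ0, hθ1, hθ⟩ : ∃ θ, 0 < θ ∧ θ ≤ 1 ∧ 4 * d * θ ≤ p.γ₁ + 2 * d := by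
    have h : 0 < (p.γ₁ + 2 * d) / (4 * d) := div_pos (by linarith) (by positivity)
    refine ⟨min 1 _, lt_min one_pos h, min_le_left _ _, ?_⟩
    rw [← le_div_iff₀' (by positivity)]
    exact min_le_right _ _
  have hden (ξ : ℝ) : θ * (1 + d * ξ ^ 2) ^ 2 ≤ p.denom ξ := by
    rw [denom, hdsq]
    nlinarith [mul_nonneg (sub_nonneg.2 hθ) (sq_nonneg ξ),
      mul_nonneg (sub_nonneg.2 hθ1) (sq_nonneg (1 - d * ξ ^ 2))]
  refine ⟨(1 + d⁻¹) ^ 2 * θ⁻¹, fun ξ => ?_⟩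
  have hb : bracket ξ ^ 2 ≤ (1 + d⁻¹) * (1 + d * ξ ^ 2) := by
    have h : (1 + d⁻¹) * (1 + d * ξ ^ 2) = 1 + ξ ^ 2 + (d⁻¹ + d * ξ ^ 2) := by
      field_simp
      ring
    rw [bracket_sq, h]
    exact le_add_of_nonneg_right (by positivity)
  calc bracket ξ ^ 4 = (bracket ξ ^ 2) ^ 2 := by ring
    _ ≤ ((1 + d⁻¹) * (1 + d * ξ ^ 2)) ^ 2 := by gcongr
    _ = (1 + d⁻¹) ^ 2 * θ⁻¹ * (θ * (1 + d * ξ ^ 2) ^ 2) := by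
        field_simp
    _ ≤ _ := by
        gcongr
        exact hden ξ

end Coeffs

end Symbols

section Nonlinearity

theorem integrable_exp_mul {g : ℝ → ℂ} (hg : Integrable g) (ξ : ℝ) :
    Integrable fun x : ℝ => Complex.exp (-Complex.I * x * ξ) * g x := by
  refine hg.bdd_mul (c := 1) (Continuous.aestronglyMeasurable (by fun_prop))
    (.of_forall fun x => ?_)
  rw [norm_phase x ξ]

theorem hatL1_add {f g : ℝ → ℂ} (hf : Integrable f) (hg : Integrable g) (ξ : ℝ) :
    hatL1 (fun x => f x + g x) ξ = hatL1 f ξ + hatL1 g ξ := by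
  simp only [hatL1, mul_add]
  exact integral_add (integrable_exp_mul hf ξ) (integrable_exp_mul hg ξ)

theorem hatL1_sub {f g : ℝ → ℂ} (hf : Integrable f) (hg : Integrable g) (ξ : ℝ) :
    hatL1 (fun x => f x - g x) ξ = hatL1 f ξ - hatL1 g ξ := by
  simp only [hatL1, mul_sub]
  exact integral_sub (integrable_exp_mul hf ξ) (integrable_exp_mul hg ξ)

theorem hatL1_neg_of_star_eq {g : ℝ → ℂ} (hg : ∀ᵐ x, star (g x) = g x) (ξ : ℝ) :
    hatL1 g (-ξ) = star (hatL1 g ξ) := by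
  rw [hatL1, hatL1, Complex.star_def, ← integral_conj]
  refine integral_congr_ae ?_
  filter_upwards [hg] with x hx
  rw [Complex.star_def] at hx
  simp [hx, ← Complex.exp_conj]

theorem hatL1_sq_sub_hatL1_sq (f g : L2C ℝ) (ξ : ℝ) :
    hatL1 (fun x => f x ^ 2) ξ - hatL1 (fun x => g x ^ 2) ξ =
      hatL1 (fun x => (f - g) x * (f + g) x) ξ := by
  simp only [sq]
  rw [← hatL1_sub (integrable_mul f f) (integrable_mul g g)]
  refine congrFun (hatL1_congr_ae ?_) ξ
  filter_upwards [Lp.coeFn_sub f g, Lp.coeFn_add f g] with x h1 h2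
  rw [h1, h2, Pi.sub_apply, Pi.add_apply]
  ring

variable {σ s : ℝ} {f g : L2C ℝ}

theorem MemGevrey.integrable_pow_three (hf : MemGevrey σ 2 f) : Integrable fun x => f x ^ 3 := by
  simpa only [pow_succ, pow_zero, one_mul] using hf.integrable_mul_mul hf f

theorem hatL1_pow_three_sub_hatL1_pow_three (hf : MemGevrey σ 2 f) (hg : MemGevrey σ 2 g) (ξ : ℝ) :
    hatL1 (fun x => f x ^ 3) ξ - hatL1 (fun x => g x ^ 3) ξ =
      hatL1 (fun x => f x * f x * (f - g) x) ξ + hatL1 (fun x => f x * g x * (f - g) x) ξ +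
        hatL1 (fun x => g x * g x * (f - g) x) ξ := by
  have hff := hf.integrable_mul_mul hf (f - g)
  have hfg := hf.integrable_mul_mul hg (f - g)
  have hgg := hg.integrable_mul_mul hg (f - g)
  have hsum : Integrable fun x => f x * f x * (f - g) x + f x * g x * (f - g) x := hff.add hfg
  rw [← hatL1_sub hf.integrable_pow_three hg.integrable_pow_three, ← hatL1_add hff hfg,
    ← hatL1_add hsum hgg]
  refine congrFun (hatL1_congr_ae ?_) ξ
  filter_upwards [Lp.coeFn_sub f g] with x h
  rw [h, Pi.sub_apply]
  ring

theorem MemGevrey.add (hf : MemGevrey σ s f) (hg : MemGevrey σ s g) :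
    MemGevrey σ s (f + g) ∧ gevreyNorm σ s (f + g) ≤ gevreyNorm σ s f + gevreyNorm σ s g := by
  have h := memGevrey_and_gevreyNorm_le_of_ae_le (f := f + g) (hf.norm.add hg.norm) (by
    filter_upwards [hatL2_add f g] with ξ hξ
    rw [hξ, ← norm_weight, ← norm_mul, mul_add]
    exact norm_add_le _ _)
  refine ⟨h.1, h.2.trans ((lpNorm_add_le hf.norm one_le_two).trans_eq ?_)⟩
  rw [lpNorm_norm hf.1, lpNorm_norm hg.1, gevreyNorm, gevreyNorm]

theorem MemGevrey.sub (hf : MemGevrey σ s f) (hg : MemGevrey σ s g) : MemGevrey σ s (f - g) := by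
  refine (memLp_congr_ae ?_).1 (MemLp.sub hf hg)
  filter_upwards [hatL2_sub f g] with ξ hξ
  rw [hξ, Pi.sub_apply, mul_sub]

variable {r : ℝ}

theorem weight_mul_norm_hatL1_sq_sub_le (hs : 0 ≤ s) (hs2 : s ≤ 2) (hf : MemGevrey σ s f)
    (hg : MemGevrey σ s g) (hfr : gevreyNorm σ s f ≤ r) (hgr : gevreyNorm σ s g ≤ r) (ξ : ℝ) :
    weight σ s ξ * ‖hatL1 (fun x => f x ^ 2) ξ - hatL1 (fun x => g x ^ 2) ξ‖ ≤
      2 * r * gevreyNorm σ s (f - g) := by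
  obtain ⟨hadd, hle⟩ := hf.add hg
  rw [hatL1_sq_sub_hatL1_sq]
  refine (weight_mul_norm_hatL1_mul_le hs hs2 (hf.sub hg) hadd ξ).trans ?_
  rw [mul_comm]
  exact mul_le_mul_of_nonneg_right (by linarith) (gevreyNorm_nonneg σ s _)

theorem weight_mul_norm_hatL1_pow_three_sub_le (hf : MemGevrey σ 2 f) (hg : MemGevrey σ 2 g)
    (hfr : gevreyNorm σ 2 f ≤ r) (hgr : gevreyNorm σ 2 g ≤ r) (ξ : ℝ) :
    weight σ 1 ξ * ‖hatL1 (fun x => f x ^ 3) ξ - hatL1 (fun x => g x ^ 3) ξ‖ ≤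
      3 * √Real.pi * r ^ 2 * gevreyNorm σ 2 (f - g) := by
  have hr : 0 ≤ r := (gevreyNorm_nonneg σ 2 f).trans hfr
  have htri {a b : L2C ℝ} (ha : MemGevrey σ 2 a) (hb : MemGevrey σ 2 b)
      (har : gevreyNorm σ 2 a ≤ r) (hbr : gevreyNorm σ 2 b ≤ r) :
      weight σ 1 ξ * ‖hatL1 (fun x => a x * b x * (f - g) x) ξ‖ ≤
        √Real.pi * (r * r * gevreyNorm σ 2 (f - g)) := by
    refine (weight_mul_norm_hatL1_mul_mul_le ha hb (hf.sub hg) ξ).trans ?_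
    have := gevreyNorm_nonneg σ 2 (f - g)
    have := gevreyNorm_nonneg σ 2 b
    gcongr
  rw [hatL1_pow_three_sub_hatL1_pow_three hf hg]
  refine (mul_le_mul_of_nonneg_left norm_add₃_le (weight_pos σ 1 ξ).le).trans ?_
  linarith [htri hf hf hfr hfr, htri hf hg hfr hgr, htri hg hg hgr hgr]

theorem toComplex_sub (f g : Lp ℝ 2 (volume : Measure ℝ)) :
    toComplex (f - g) = toComplex f - toComplex g := by
  rw [eq_sub_iff_add_eq, ← toComplex_add, sub_add_cancel]

namespace GevreyH

theorem dx_sub (u v : GevreyH σ 2) : (u - v).dx = u.dx - v.dx := by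
  refine eq_of_hatL2_ae_eq ?_
  filter_upwards [hatL2_dx (u - v), hatL2_dx u, hatL2_dx v, hatL2_sub u.dx v.dx,
    hat_toL2_sub u v] with ξ huv hu hv hsub hhat
  rw [huv, hsub, hu, hv, hhat, mul_sub]

theorem star_dx (u : GevreyH σ 2) : star u.dx = u.dx := by
  refine eq_of_hatL2_ae_eq ?_
  filter_upwards [hatL2_star u.dx, hatL2_dx u, ae_neg (hatL2_dx u), hat_neg u.toL2]
    with ξ hstar hu hneg hhat
  rw [hstar, hneg, hu, hhat]
  simp

end GevreyH

variable {p : Coeffs} {C : ℝ}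

theorem Coeffs.IsEllipticWith.weight_mul_norm_multipliers_le (hp : p.IsEllipticWith C)
    (σ ξ : ℝ) (a b c : ℂ) :
    weight σ 2 ξ * ‖p.tau ξ * a - 7 / 48 * p.psi ξ * b - 1 / 8 * p.psi ξ * c‖ ≤
      C * (bracket ξ)⁻¹ * ((1 + |p.γ|) * (weight σ 2 ξ * ‖a‖) + 7 / 48 * (weight σ 1 ξ * ‖b‖) +
        1 / 8 * (weight σ 1 ξ * ‖c‖)) := by
  have hw := weight_pos σ 1 ξ
  have hw2 := (weight_pos σ 2 ξ).le
  have hτ : weight σ 2 ξ * ‖p.tau ξ * a‖ ≤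
      (1 + |p.γ|) * (C * (bracket ξ)⁻¹) * (weight σ 2 ξ * ‖a‖) := by
    rw [norm_mul, Complex.norm_real, Real.norm_eq_abs, mul_left_comm]
    exact mul_le_mul_of_nonneg_right (hp.abs_tau_le ξ) (by positivity)
  have hψ (q z : ℂ) : weight σ 2 ξ * ‖q * p.psi ξ * z‖ ≤
      ‖q‖ * (C * (bracket ξ)⁻¹ * (weight σ 1 ξ * ‖z‖)) := by
    rw [norm_mul, norm_mul, Complex.norm_real, Real.norm_eq_abs, ← weight_one_mul_bracket]
    calc weight σ 1 ξ * bracket ξ * (‖q‖ * |p.psi ξ| * ‖z‖)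
        = ‖q‖ * (bracket ξ * |p.psi ξ| * (weight σ 1 ξ * ‖z‖)) := by ring
      _ ≤ _ := mul_le_mul_of_nonneg_left
          (mul_le_mul_of_nonneg_right (hp.bracket_mul_abs_psi_le ξ) (by positivity)) (norm_nonneg q)
  have hb := hψ (7 / 48) b
  have hc := hψ (1 / 8) c
  rw [show ‖(7 / 48 : ℂ)‖ = 7 / 48 by norm_num] at hb
  rw [show ‖(1 / 8 : ℂ)‖ = 1 / 8 by norm_num] at hc
  calc _ ≤ weight σ 2 ξ * (‖p.tau ξ * a‖ + ‖7 / 48 * p.psi ξ * b‖ + ‖1 / 8 * p.psi ξ * c‖) := by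
        gcongr
        exact (norm_sub_le _ _).trans (by gcongr; exact norm_sub_le _ _)
    _ ≤ _ := by linarith

namespace GevreyH

theorem weight_mul_norm_nonlinHat_sub_le (hp : p.IsEllipticWith C) {u v : GevreyH σ 2}
    (hu : ‖u‖ ≤ r) (hv : ‖v‖ ≤ r) (ξ : ℝ) :
    weight σ 2 ξ * ‖p.nonlinHat u ξ - p.nonlinHat v ξ‖ ≤
      (3 + 2 * |p.γ|) * C * (r + r ^ 2) * ‖u - v‖ * (bracket ξ)⁻¹ := by
  have hC := hp.pos
  have hr : 0 ≤ r := (norm_nonneg u).trans hu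
  have hN : gevreyNorm σ 2 (toComplex u.toL2 - toComplex v.toL2) = ‖u - v‖ := by
    rw [← gevreyNorm_toComplex, ← toComplex_sub]
    rfl
  have hu' := u.gevreyNorm_toComplex.trans_le hu
  have hv' := v.gevreyNorm_toComplex.trans_le hv
  have hsq := weight_mul_norm_hatL1_sq_sub_le zero_le_two le_rfl u.memGevrey_toComplex
    v.memGevrey_toComplex hu' hv' ξ
  have hdx := weight_mul_norm_hatL1_sq_sub_le zero_le_one one_le_two u.memGevrey_dx.1
    v.memGevrey_dx.1 (u.memGevrey_dx.2.trans hu) (v.memGevrey_dx.2.trans hv) ξ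
  have hcube := weight_mul_norm_hatL1_pow_three_sub_le u.memGevrey_toComplex
    v.memGevrey_toComplex hu' hv' ξ
  rw [hN] at hsq hcube
  rw [← dx_sub] at hdx
  have hdx' := hdx.trans (mul_le_mul_of_nonneg_left (u - v).memGevrey_dx.2 (by positivity))
  have hcoeff : (1 + |p.γ|) * (2 * r) + 7 / 48 * (2 * r) + 1 / 8 * (3 * √Real.pi * r ^ 2) ≤
      (3 + 2 * |p.γ|) * (r + r ^ 2) := by
    have hπ : √Real.pi ≤ 2 := Real.sqrt_le_iff.2 ⟨zero_le_two, by linarith [Real.pi_le_four]⟩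
    nlinarith [mul_nonneg (abs_nonneg p.γ) (sq_nonneg r),
      mul_le_mul_of_nonneg_right hπ (sq_nonneg r)]
  have h := hp.weight_mul_norm_multipliers_le σ ξ
    (hatL1 (fun x => toComplex u.toL2 x ^ 2) ξ - hatL1 (fun x => toComplex v.toL2 x ^ 2) ξ)
    (hatL1 (fun x => u.dx x ^ 2) ξ - hatL1 (fun x => v.dx x ^ 2) ξ)
    (hatL1 (fun x => toComplex u.toL2 x ^ 3) ξ - hatL1 (fun x => toComplex v.toL2 x ^ 3) ξ)
  have hb : 0 < (bracket ξ)⁻¹ := inv_pos.2 (bracket_pos ξ)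
  calc weight σ 2 ξ * ‖p.nonlinHat u ξ - p.nonlinHat v ξ‖
      ≤ C * (bracket ξ)⁻¹ * ((1 + |p.γ|) * (2 * r * ‖u - v‖) + 7 / 48 * (2 * r * ‖u - v‖) +
          1 / 8 * (3 * √Real.pi * r ^ 2 * ‖u - v‖)) := by
        refine (le_of_eq ?_).trans (h.trans ?_)
        · simp only [Coeffs.nonlinHat]
          congr 2
          ring
        · gcongr
    _ = C * (bracket ξ)⁻¹ * ‖u - v‖ *
          ((1 + |p.γ|) * (2 * r) + 7 / 48 * (2 * r) + 1 / 8 * (3 * √Real.pi * r ^ 2)) := by ring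
    _ ≤ C * (bracket ξ)⁻¹ * ‖u - v‖ * ((3 + 2 * |p.γ|) * (r + r ^ 2)) := by gcongr
    _ = _ := by ring

theorem nonlinHat_zero (p : Coeffs) (ξ : ℝ) : p.nonlinHat (0 : GevreyH σ 2) ξ = 0 := by
  have hu : toComplex (0 : GevreyH σ 2).toL2 = 0 := by
    have h := toComplex_sub (0 : GevreyH σ 2).toL2 (0 : GevreyH σ 2).toL2
    rwa [sub_self, sub_self] at h
  have hdx : (0 : GevreyH σ 2).dx = 0 := by
    simpa only [sub_self] using dx_sub (0 : GevreyH σ 2) 0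
  have hpow (n : ℕ) (hn : n ≠ 0) : hatL1 (fun x => (0 : L2C ℝ) x ^ n) ξ = 0 := by
    rw [hatL1_congr_ae (g := fun _ => 0)]
    · simp [hatL1]
    · filter_upwards [Lp.coeFn_zero ℂ 2 (volume : Measure ℝ)] with x hx
      rw [hx, Pi.zero_apply, zero_pow hn]
  rw [Coeffs.nonlinHat, hu, hdx, hpow 2 two_ne_zero, hpow 3 three_ne_zero]
  simp

theorem measurable_nonlinHat (p : Coeffs) (u : GevreyH σ 2) : Measurable (p.nonlinHat u) := by
  have hsq (f : L2C ℝ) : Measurable (hatL1 fun x => f x ^ 2) := by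
    simpa only [sq] using (continuous_hatL1 (integrable_mul f f)).measurable
  have hcube := (continuous_hatL1 u.memGevrey_toComplex.integrable_pow_three).measurable
  have hτ := p.measurable_tau
  have hψ := p.measurable_psi
  unfold Coeffs.nonlinHat
  fun_prop

theorem nonlinHat_neg (p : Coeffs) (u : GevreyH σ 2) (ξ : ℝ) :
    p.nonlinHat u (-ξ) = -star (p.nonlinHat u ξ) := by
  have hpow (f : L2C ℝ) (hf : star f = f) (n : ℕ) :
      hatL1 (fun x => f x ^ n) (-ξ) = star (hatL1 (fun x => f x ^ n) ξ) := by
    refine hatL1_neg_of_star_eq ?_ ξ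
    filter_upwards [hf ▸ Lp.coeFn_star f] with x hx
    rw [star_pow]
    exact congrArg (· ^ n) hx.symm
  have hu := hpow _ (star_toComplex u.toL2)
  rw [Coeffs.nonlinHat, Coeffs.nonlinHat, hu, hu, hpow _ u.star_dx, p.tau_neg, p.psi_neg]
  simp
  ring

theorem exists_nonlin (hp : p.IsEllipticWith C) (u : GevreyH σ 2) :
    ∃ g : GevreyH σ 2, hat g.toL2 =ᵐ[volume] fun ξ => -Complex.I * p.nonlinHat u ξ := by
  refine exists_of_hat zero_le_two ?_ (.of_forall fun ξ => ?_)
  · have hw := (continuous_weight σ 2).measurable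
    have hm := measurable_nonlinHat p u
    refine (memLp_mul_inv_bracket ((3 + 2 * |p.γ|) * C * (‖u‖ + ‖u‖ ^ 2) * ‖u‖)).mono'
      (Measurable.aestronglyMeasurable (by fun_prop)) (.of_forall fun ξ => ?_)
    rw [norm_mul, norm_mul, norm_neg, Complex.norm_I, one_mul, norm_weight]
    simpa only [nonlinHat_zero, sub_zero] using
      weight_mul_norm_nonlinHat_sub_le hp le_rfl (norm_zero.trans_le (norm_nonneg u)) ξ
  · rw [nonlinHat_neg]
    simp

/-- The nonlinearity `-iF(u)` of the evolution equation, as an element of `H^{σ,2}(ℝ)`. -/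
def nonlin (hp : p.IsEllipticWith C) (u : GevreyH σ 2) : GevreyH σ 2 := (exists_nonlin hp u).choose

theorem hat_nonlin (hp : p.IsEllipticWith C) (u : GevreyH σ 2) :
    hat (nonlin hp u).toL2 =ᵐ[volume] fun ξ => -Complex.I * p.nonlinHat u ξ :=
  (exists_nonlin hp u).choose_spec

theorem nonlin_zero (hp : p.IsEllipticWith C) : nonlin hp (0 : GevreyH σ 2) = 0 := by
  refine ext_hat ?_
  filter_upwards [hat_nonlin hp (0 : GevreyH σ 2), hat_toL2_sub (0 : GevreyH σ 2) 0] with ξ h h0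
  rw [sub_self, sub_self] at h0
  rw [h, h0, nonlinHat_zero, mul_zero]

theorem norm_nonlin_sub_le (hp : p.IsEllipticWith C) {u v : GevreyH σ 2} (hu : ‖u‖ ≤ r)
    (hv : ‖v‖ ≤ r) :
    ‖nonlin hp u - nonlin hp v‖ ≤
      √Real.pi * ((3 + 2 * |p.γ|) * C) * (r + r ^ 2) * ‖u - v‖ := by
  have hr : 0 ≤ r := (norm_nonneg u).trans hu
  have hC := hp.pos
  refine (norm_le_of_ae_le _ (memLp_mul_inv_bracket _) ?_).trans_eq
    ((lpNorm_mul_inv_bracket (C := (3 + 2 * |p.γ|) * C * (r + r ^ 2) * ‖u - v‖)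
      (by positivity)).trans (by ring))
  filter_upwards [hat_toL2_sub (nonlin hp u) (nonlin hp v), hat_nonlin hp u, hat_nonlin hp v]
    with ξ hsub hu' hv'
  rw [hsub, hu', hv', ← mul_sub, norm_mul, norm_neg, Complex.norm_I, one_mul]
  exact weight_mul_norm_nonlinHat_sub_le hp hu hv ξ

end GevreyH

end Nonlinearity

section IntegralEquation

variable {E : Type*} [NormedAddCommGroup E] {f : ℝ → E → E} {L : ℝ → NNReal} {T : ℝ}

theorem continuousOn_uncurry_closedBall
    (hL : ∀ t r, LipschitzOnWith (L r) (f t) (Metric.closedBall 0 r))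
    (hc : ∀ x, Continuous (f · x)) (I : Set ℝ) (r : ℝ) :
    ContinuousOn (Function.uncurry f) (I ×ˢ Metric.closedBall 0 r) :=
  continuousOn_prod_of_continuousOn_lipschitzOnWith' _ (L r) (fun t _ => hL t r)
    fun x _ => (hc x).continuousOn

theorem exists_mapsTo_closedBall {v : ℝ → E} (hv : ContinuousOn v (Icc 0 T)) :
    ∃ r, MapsTo v (Icc 0 T) (Metric.closedBall 0 r) := by
  obtain ⟨r, hr⟩ := isCompact_Icc.exists_bound_of_continuousOn hv
  exact ⟨r, fun t ht => mem_closedBall_zero_iff.2 (hr t ht)⟩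

theorem continuous_of_lipschitzOnWith_closedBall {F : Type*} [PseudoMetricSpace F]
    {N : E → F} (hN : ∀ r, LipschitzOnWith (L r) N (Metric.closedBall 0 r)) : Continuous N :=
  continuous_iff_continuousAt.2 fun x => (hN (‖x‖ + 1)).continuousOn.continuousAt
    (Filter.mem_of_superset (Metric.isOpen_ball.mem_nhds (by simp)) Metric.ball_subset_closedBall)

theorem isPicardLindelof_of_zero
    (hL : ∀ t r, LipschitzOnWith (L r) (f t) (Metric.closedBall 0 r))
    (hc : ∀ x, Continuous (f · x)) (hf0 : ∀ t, f t 0 = 0) (hT : 0 ≤ T) {R : NNReal}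
    (hRT : 2 * L (2 * R) * T ≤ 1) :
    IsPicardLindelof f (tmin := 0) (tmax := T) ⟨0, le_rfl, hT⟩ 0 (2 * R) R (L (2 * R) * (2 * R))
      (L (2 * R)) where
  lipschitzOnWith t _ := hL t _
  continuousOn x _ := (hc x).continuousOn
  norm_le t _ x hx := by
    have h := (hL t _).norm_sub_le hx (Metric.mem_closedBall_self (by positivity))
    rw [hf0, sub_zero, sub_zero] at h
    exact h.trans (mul_le_mul_of_nonneg_left (mem_closedBall_zero_iff.1 hx) (NNReal.coe_nonneg _))
  mul_max_le := by
    rw [sub_self, sub_zero, max_eq_left hT]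
    push_cast
    nlinarith [R.coe_nonneg]

variable [NormedSpace ℝ E] [CompleteSpace E] {v w : ℝ → E} {x : E}

theorem hasDerivWithinAt_of_eq_integral
    (hL : ∀ t r, LipschitzOnWith (L r) (f t) (Metric.closedBall 0 r))
    (hc : ∀ x, Continuous (f · x)) (hv : ContinuousOn v (Icc 0 T))
    (h : ∀ t ∈ Icc 0 T, v t = x + ∫ s in (0 : ℝ)..t, f s (v s)) {t : ℝ} (ht : t ∈ Icc 0 T) :
    HasDerivWithinAt v (f t (v t)) (Icc 0 T) t := by
  obtain ⟨r, hr⟩ := exists_mapsTo_closedBall hv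
  exact (ODE.hasDerivWithinAt_picard_Icc ⟨le_rfl, ht.1.trans ht.2⟩
    (continuousOn_uncurry_closedBall hL hc (Icc 0 T) r) hv hr x ht).congr_of_mem h ht

theorem eqOn_of_eq_integral
    (hL : ∀ t r, LipschitzOnWith (L r) (f t) (Metric.closedBall 0 r))
    (hc : ∀ x, Continuous (f · x)) (hv : ContinuousOn v (Icc 0 T)) (hw : ContinuousOn w (Icc 0 T))
    (hvx : ∀ t ∈ Icc 0 T, v t = x + ∫ s in (0 : ℝ)..t, f s (v s))
    (hwx : ∀ t ∈ Icc 0 T, w t = x + ∫ s in (0 : ℝ)..t, f s (w s)) : EqOn v w (Icc 0 T) := by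
  intro t₀ ht₀
  have h0 : (0 : ℝ) ∈ Icc 0 T := ⟨le_rfl, ht₀.1.trans ht₀.2⟩
  obtain ⟨r₁, hr₁⟩ := exists_mapsTo_closedBall hv
  obtain ⟨r₂, hr₂⟩ := exists_mapsTo_closedBall hw
  have hderiv {z : ℝ → E} (hz : ContinuousOn z (Icc 0 T))
      (hzx : ∀ t ∈ Icc 0 T, z t = x + ∫ s in (0 : ℝ)..t, f s (z s)) (t : ℝ) (ht : t ∈ Ico 0 T) :
      HasDerivWithinAt z (f t (z t)) (Ici t) t :=
    (hasDerivWithinAt_of_eq_integral hL hc hz hzx (Ico_subset_Icc_self ht)).mono_of_mem_nhdsWithin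
      (Icc_mem_nhdsGE_of_mem ht)
  refine ODE_solution_unique_of_mem_Icc_right (v := f)
    (s := fun _ => Metric.closedBall 0 (max r₁ r₂)) (fun t _ => hL t _)
    hv (hderiv hv hvx) (fun t ht => Metric.closedBall_subset_closedBall (le_max_left _ _)
      (hr₁ (Ico_subset_Icc_self ht)))
    hw (hderiv hw hwx) (fun t ht => Metric.closedBall_subset_closedBall (le_max_right _ _)
      (hr₂ (Ico_subset_Icc_self ht))) ?_ ht₀
  rw [hvx 0 h0, hwx 0 h0, intervalIntegral.integral_same, intervalIntegral.integral_same]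

theorem exists_flow
    (hL : ∀ t r, LipschitzOnWith (L r) (f t) (Metric.closedBall 0 r))
    (hc : ∀ x, Continuous (f · x)) (hf0 : ∀ t, f t 0 = 0) (hT : 0 ≤ T) {R : NNReal}
    (hRT : 2 * L (2 * R) * T ≤ 1) :
    ∃ α : E → ℝ → E, (∀ x ∈ Metric.closedBall (0 : E) R, ContinuousOn (α x) (Icc 0 T) ∧
      ∀ t ∈ Icc 0 T, α x t = x + ∫ s in (0 : ℝ)..t, f s (α x s)) ∧
      ∃ M : NNReal, ∀ t ∈ Icc 0 T, LipschitzOnWith M (α · t) (Metric.closedBall 0 R) := by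
  obtain ⟨α, hα, M, hM⟩ := (isPicardLindelof_of_zero hL hc hf0 hT
    hRT).exists_forall_mem_closedBall_eq_hasDerivWithinAt_lipschitzOnWith
  refine ⟨α, fun x hx => ?_, M, hM⟩
  obtain ⟨h0 : α x 0 = x, hderiv⟩ := hα x hx
  have hcont : ContinuousOn (α x) (Icc 0 T) := HasDerivWithinAt.continuousOn hderiv
  obtain ⟨r, hr⟩ := exists_mapsTo_closedBall hcont
  refine ⟨hcont, fun t ht => ?_⟩
  have hsub : uIcc 0 t ⊆ Icc 0 T := uIcc_subset_Icc ⟨le_rfl, hT⟩ ht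
  have h := ODE.picard_eq_of_hasDerivAt (continuousOn_uncurry_closedBall hL hc (uIcc 0 t) r)
    (fun s hs => (hderiv s (hsub hs)).mono hsub) (hr.mono_left hsub)
  rwa [ODE.picard_apply, h0, eq_comm] at h

end IntegralEquation

section SemilinearEvolution

variable {E : Type*} [NormedAddCommGroup E] [NormedSpace ℝ E]

/-- A strongly continuous one-parameter group of linear isometries: the solution operators of a
linear evolution equation `u' = Au`. -/
structure IsStronglyContinuousGroup (S : ℝ → E →ₗᵢ[ℝ] E) : Prop where
  map_zero (x : E) : S 0 x = x
  map_add (t r : ℝ) (x : E) : S (t + r) x = S t (S r x)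
  continuous_apply (x : E) : Continuous fun t => S t x

/-- Mild solutions on `[0, T]` of `u' = Au + N(u)`, `u(0) = x`, given by Duhamel's formula in terms
of the group `S` generated by `A`. Outside `[0, T]` the path is extended by its endpoint values. -/
def IsDuhamelSolution (S : ℝ → E →ₗᵢ[ℝ] E) (N : E → E) {T : ℝ} (hT : 0 ≤ T) (x : E)
    (u : C(Icc 0 T, E)) : Prop :=
  ∀ t : Icc 0 T, u t = S t x + ∫ s in (0 : ℝ)..t, S (t - s) (N (IccExtend hT u s))

/-- The vector field of `u' = Au + N(u)` in the interaction picture `v(t) = S(-t)u(t)`. -/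
def interactionField (S : ℝ → E →ₗᵢ[ℝ] E) (N : E → E) (t : ℝ) (x : E) : E := S (-t) (N (S t x))

variable {S : ℝ → E →ₗᵢ[ℝ] E} {N : E → E} {L : ℝ → NNReal}

namespace IsStronglyContinuousGroup

theorem continuous_uncurry (hS : IsStronglyContinuousGroup S) :
    Continuous fun q : ℝ × E => S q.1 q.2 :=
  continuous_prod_of_continuous_lipschitzWith' _ 1 (fun t => (S t).lipschitz) hS.continuous_apply

theorem map_neg_map (hS : IsStronglyContinuousGroup S) (t : ℝ) (x : E) : S (-t) (S t x) = x := by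
  rw [← hS.map_add, neg_add_cancel, hS.map_zero]

theorem map_map_neg (hS : IsStronglyContinuousGroup S) (t : ℝ) (x : E) : S t (S (-t) x) = x := by
  rw [← hS.map_add, add_neg_cancel, hS.map_zero]

end IsStronglyContinuousGroup

theorem lipschitzOnWith_interactionField (S : ℝ → E →ₗᵢ[ℝ] E)
    (hN : ∀ r, LipschitzOnWith (L r) N (Metric.closedBall 0 r)) (t r : ℝ) :
    LipschitzOnWith (L r) (interactionField S N t) (Metric.closedBall 0 r) := by
  have hmaps : MapsTo (S t) (Metric.closedBall 0 r) (Metric.closedBall 0 r) := fun x hx => by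
    rwa [mem_closedBall_zero_iff, (S t).norm_map, ← mem_closedBall_zero_iff]
  simpa only [one_mul, mul_one] using! (S (-t)).lipschitz.comp_lipschitzOnWith
    ((hN r).comp (S t).lipschitz.lipschitzOnWith hmaps)

theorem continuous_interactionField (hS : IsStronglyContinuousGroup S) (hN : Continuous N)
    (x : E) : Continuous (interactionField S N · x) :=
  hS.continuous_uncurry.comp₂ continuous_neg (hN.comp (hS.continuous_apply x))

variable {T : ℝ} [CompleteSpace E]

theorem isDuhamelSolution_iff_interactionField (hS : IsStronglyContinuousGroup S) (N : E → E)
    (hT : 0 ≤ T) (x : E) (u : C(Icc 0 T, E)) :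
    IsDuhamelSolution S N hT x u ↔ ∀ t ∈ Icc 0 T, S (-t) (IccExtend hT u t) =
      x + ∫ s in (0 : ℝ)..t, interactionField S N s (S (-s) (IccExtend hT u s)) := by
  simp only [IsDuhamelSolution, Subtype.forall, interactionField, hS.map_map_neg]
  refine forall₂_congr fun t ht => ?_
  have hint : ∫ s in (0 : ℝ)..t, S (t - s) (N (IccExtend hT u s)) =
      S t (∫ s in (0 : ℝ)..t, S (-s) (N (IccExtend hT u s))) := by
    simp only [sub_eq_add_neg, hS.map_add]
    exact (S t).intervalIntegral_comp_comm _
  rw [IccExtend_of_mem hT _ ht, hint, ← _root_.map_add]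
  exact ⟨fun h => by rw [h, hS.map_neg_map], fun h => by rw [← h, hS.map_map_neg]⟩

theorem IsDuhamelSolution.unique (hS : IsStronglyContinuousGroup S)
    (hN : ∀ r, LipschitzOnWith (L r) N (Metric.closedBall 0 r)) {hT : 0 ≤ T} {x : E}
    {u v : C(Icc 0 T, E)} (hu : IsDuhamelSolution S N hT x u)
    (hv : IsDuhamelSolution S N hT x v) : u = v := by
  have hcont (w : C(Icc 0 T, E)) : ContinuousOn (fun t => S (-t) (IccExtend hT w t)) (Icc 0 T) :=
    (hS.continuous_uncurry.comp₂ continuous_neg w.continuous.Icc_extend').continuousOn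
  have heq := eqOn_of_eq_integral (lipschitzOnWith_interactionField S hN)
    (continuous_interactionField hS (continuous_of_lipschitzOnWith_closedBall hN))
    (hcont u) (hcont v) ((isDuhamelSolution_iff_interactionField hS N hT x u).1 hu)
    ((isDuhamelSolution_iff_interactionField hS N hT x v).1 hv)
  ext1 t
  simpa only [IccExtend_val] using (S (-t)).injective (heq t.2)

theorem exists_continuousOn_isDuhamelSolution_iff (hS : IsStronglyContinuousGroup S)
    (hN : ∀ r, LipschitzOnWith (L r) N (Metric.closedBall 0 r)) (hN0 : N 0 = 0) (hT : 0 ≤ T)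
    {R : NNReal} (hRT : 2 * L (2 * R) * T ≤ 1) :
    ∃ Φ : E → C(Icc 0 T, E), ContinuousOn Φ (Metric.closedBall 0 R) ∧
      ∀ x ∈ Metric.closedBall (0 : E) R, ∀ u, IsDuhamelSolution S N hT x u ↔ u = Φ x := by
  classical
  obtain ⟨α, hα, M, hM⟩ := exists_flow (lipschitzOnWith_interactionField S hN)
    (continuous_interactionField hS (continuous_of_lipschitzOnWith_closedBall hN))
    (fun t => by rw [interactionField, _root_.map_zero, hN0, _root_.map_zero]) hT hRT
  have hcont (x : E) (hx : x ∈ Metric.closedBall (0 : E) R) :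
      Continuous fun t : Icc 0 T => S t (α x t) :=
    hS.continuous_uncurry.comp₂ continuous_subtype_val
      (continuousOn_iff_continuous_domRestrict.1 (hα x hx).1)
  choose! Φ hΦ using fun x hx => show ∃ u : C(Icc 0 T, E), ∀ t, u t = S t (α x t) from
    ⟨⟨_, hcont x hx⟩, fun _ => rfl⟩
  have hsol (x : E) (hx : x ∈ Metric.closedBall (0 : E) R) : IsDuhamelSolution S N hT x (Φ x) := by
    have hα' (t : ℝ) (ht : t ∈ Icc 0 T) : S (-t) (IccExtend hT (Φ x) t) = α x t := by
      rw [IccExtend_of_mem hT _ ht, hΦ x hx, hS.map_neg_map]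
    rw [isDuhamelSolution_iff_interactionField hS]
    intro t ht
    rw [hα' t ht, (hα x hx).2 t ht]
    refine congrArg (x + ·) (intervalIntegral.integral_congr fun s hs => ?_)
    rw [hα' s (uIcc_subset_Icc ⟨le_rfl, hT⟩ ht hs)]
  refine ⟨Φ, LipschitzOnWith.continuousOn (K := M) (.of_dist_le_mul fun x hx y hy => ?_),
    fun x hx u => ⟨fun hu => hu.unique hS hN (hsol x hx), fun hu => hu ▸ hsol x hx⟩⟩
  refine (ContinuousMap.dist_le (by positivity)).2 fun t => ?_
  rw [hΦ x hx, hΦ y hy, (S t).dist_map]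
  exact (hM t t.2).dist_le_mul x hx y hy

end SemilinearEvolution

section PointwiseIntegral

variable {α 𝕜 : Type*} [MeasurableSpace α] {μ : Measure α} [RCLike 𝕜] {G : ℝ → Lp 𝕜 2 μ}
  {h : ℝ → α → 𝕜} {A : Set α}

theorem setIntegral_norm_le_add_sq_norm (hA : μ A ≠ ⊤) (f : Lp 𝕜 2 μ) :
    ∫ x in A, ‖f x‖ ∂μ ≤ μ.real A + ‖f‖ ^ 2 := by
  have hf := Lp.memLp f
  have hsq : Integrable (fun x => ‖f x‖ ^ 2) μ := (memLp_two_iff_integrable_sq_norm hf.1).1 hf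
  have hone : IntegrableOn (fun _ => (1 : ℝ)) A μ := integrableOn_const hA
  calc ∫ x in A, ‖f x‖ ∂μ ≤ ∫ x in A, (1 + ‖f x‖ ^ 2) ∂μ := by
        refine integral_mono_of_nonneg (.of_forall fun x => norm_nonneg _)
          (hone.add hsq.integrableOn) (.of_forall fun x => ?_)
        nlinarith [sq_nonneg (‖f x‖ - 1)]
    _ = μ.real A + ∫ x in A, ‖f x‖ ^ 2 ∂μ := by
        rw [integral_add hone hsq.integrableOn, setIntegral_const, smul_eq_mul, mul_one]
    _ ≤ μ.real A + ∫ x, ‖f x‖ ^ 2 ∂μ := by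
        gcongr
        · exact .of_forall fun x => sq_nonneg _
        · exact Measure.restrict_le_self
    _ = μ.real A + ‖f‖ ^ 2 := by
        rw [← lpNorm_two_sq hf.1, Lp.norm_def, toReal_eLpNorm hf.1]

variable [SigmaFinite μ]

theorem integrable_uncurry_of_coeFn_ae_eq (hG : Continuous G)
    (hh : Measurable (Function.uncurry h)) (hGh : ∀ s, G s =ᵐ[μ] h s) (hA : μ A ≠ ⊤) (a b : ℝ) :
    Integrable (Function.uncurry h) ((volume.restrict (uIoc a b)).prod (μ.restrict A)) := by
  have : IsFiniteMeasure (μ.restrict A) := ⟨by simpa using hA.lt_top⟩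
  have hm := hh.aestronglyMeasurable (μ := (volume.restrict (uIoc a b)).prod (μ.restrict A))
  refine (integrable_prod_iff hm).2 ⟨.of_forall fun s => ?_, ?_⟩
  · exact (((Lp.memLp (G s)).restrict A).integrable one_le_two).congr (ae_restrict_of_ae (hGh s))
  · have hbound : Continuous fun s => μ.real A + ‖G s‖ ^ 2 := by fun_prop
    refine (intervalIntegrable_iff.1 (hbound.intervalIntegrable a b)).mono'
      hm.norm.integral_prod_right' (.of_forall fun s => ?_)
    rw [Real.norm_of_nonneg (integral_nonneg fun x => norm_nonneg _)]
    refine (integral_congr_ae (ae_restrict_of_ae ?_)).trans_le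
      (setIntegral_norm_le_add_sq_norm hA (G s))
    filter_upwards [hGh s] with x hx
    rw [hx, Function.uncurry_apply_pair]

theorem coeFn_intervalIntegral_ae_eq (hG : Continuous G)
    (hh : Measurable (Function.uncurry h)) (hGh : ∀ s, G s =ᵐ[μ] h s) (a b : ℝ) :
    (∫ s in a..b, G s : Lp 𝕜 2 μ) =ᵐ[μ] fun x => ∫ s in a..b, h s x := by
  have hint (A : Set α) (hA : μ A < ⊤) := integrable_uncurry_of_coeFn_ae_eq hG hh hGh hA.ne a b
  refine ae_eq_of_forall_setIntegral_eq_of_sigmaFinite (fun A _ hA => ?_) (fun A _ hA => ?_)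
    fun A hA hμA => ?_
  · have : IsFiniteMeasure (μ.restrict A) := ⟨by simpa using hA⟩
    exact ((Lp.memLp _).restrict A).integrable one_le_two
  · have := (hint A hA).integral_prod_right
    simp only [intervalIntegral.intervalIntegral_eq_integral_uIoc]
    exact this.smul _
  · let ℓ : Lp 𝕜 2 μ →L[𝕜] 𝕜 := innerSL 𝕜 (indicatorConstLp 2 hA hμA.ne 1)
    have hℓ (f : Lp 𝕜 2 μ) : ℓ f = ∫ x in A, f x ∂μ := L2.inner_indicatorConstLp_one hA hμA.ne f
    rw [← hℓ, ← ℓ.intervalIntegral_comp_comm (hG.intervalIntegrable a b),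
      ← intervalIntegral_integral_swap (hint A hμA)]
    refine intervalIntegral.integral_congr fun s _ => ?_
    rw [hℓ]
    exact integral_congr_ae (ae_restrict_of_ae (hGh s))

end PointwiseIntegral

section MildSolution

variable {σ s : ℝ} {p : Coeffs} {C : ℝ}

namespace GevreyH

theorem hat_intervalIntegral [CompleteSpace (GevreyH σ s)] {G : ℝ → GevreyH σ s} {h : ℝ → ℝ → ℂ}
    (hG : Continuous G) (hh : Measurable (Function.uncurry h))
    (hGh : ∀ r, hat (G r).toL2 =ᵐ[volume] h r) (a b : ℝ) :
    hat (∫ r in a..b, G r).toL2 =ᵐ[volume] fun ξ => ∫ r in a..b, h r ξ := by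
  have hW := (isometry_weighted σ s).continuous
  let W : GevreyH σ s →L[ℝ] L2C ℝ := ⟨weighted σ s, hW⟩
  have hw := (continuous_weight σ s).measurable
  have hae := coeFn_intervalIntegral_ae_eq (G := fun r => W (G r))
    (h := fun r ξ => weight σ s ξ * h r ξ) (W.continuous.comp hG)
    (by simp only [Function.uncurry_def] at hh ⊢; fun_prop) (fun r => by
      filter_upwards [coeFn_weighted (G r), hGh r] with ξ h1 h2
      rw [← h2]
      exact h1) a b
  rw [W.intervalIntegral_comp_comm (hG.intervalIntegrable a b)] at hae
  filter_upwards [hae, coeFn_weighted (∫ r in a..b, G r)] with ξ h1 h2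
  rw [intervalIntegral.integral_const_mul] at h1
  exact mul_left_cancel₀ (Complex.ofReal_ne_zero.2 (weight_pos σ s ξ).ne') (h2.symm.trans h1)

theorem isStronglyContinuousGroup_evolve (p : Coeffs) :
    IsStronglyContinuousGroup (evolve p : ℝ → GevreyH σ s →ₗᵢ[ℝ] GevreyH σ s) :=
  ⟨evolve_zero p, evolve_add p, continuous_evolve_apply p⟩

theorem lipschitzOnWith_nonlin (hp : p.IsEllipticWith C) (σ r : ℝ) :
    LipschitzOnWith (√Real.pi * ((3 + 2 * |p.γ|) * C) * (r + r ^ 2)).toNNReal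
      (nonlin hp : GevreyH σ 2 → GevreyH σ 2) (Metric.closedBall 0 r) := by
  refine .of_dist_le' fun u hu v hv => ?_
  rw [dist_eq_norm, dist_eq_norm]
  exact norm_nonlin_sub_le hp (mem_closedBall_zero_iff.1 hu) (mem_closedBall_zero_iff.1 hv)

theorem continuous_nonlin (hp : p.IsEllipticWith C) :
    Continuous (nonlin hp : GevreyH σ 2 → GevreyH σ 2) :=
  continuous_of_lipschitzOnWith_closedBall (lipschitzOnWith_nonlin hp σ)

theorem continuous_nonlinHat_apply (hp : p.IsEllipticWith C) (ξ : ℝ) :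
    Continuous fun u : GevreyH σ 2 => p.nonlinHat u ξ := by
  refine continuous_of_lipschitzOnWith_closedBall
    (L := fun r => ((3 + 2 * |p.γ|) * C * (r + r ^ 2)).toNNReal)
    fun r => .of_dist_le' fun u hu v hv => ?_
  rw [mem_closedBall_zero_iff] at hu hv
  have hr : 0 ≤ r := (norm_nonneg u).trans hu
  have hC := hp.pos
  rw [dist_eq_norm, dist_eq_norm]
  calc ‖p.nonlinHat u ξ - p.nonlinHat v ξ‖
      ≤ weight σ 2 ξ * ‖p.nonlinHat u ξ - p.nonlinHat v ξ‖ :=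
        le_mul_of_one_le_left (norm_nonneg _) (one_le_weight zero_le_two σ ξ)
    _ ≤ (3 + 2 * |p.γ|) * C * (r + r ^ 2) * ‖u - v‖ * (bracket ξ)⁻¹ :=
        weight_mul_norm_nonlinHat_sub_le hp hu hv ξ
    _ ≤ (3 + 2 * |p.γ|) * C * (r + r ^ 2) * ‖u - v‖ :=
        mul_le_of_le_one_right (by positivity) (inv_le_one_of_one_le₀ (one_le_bracket ξ))

theorem hat_duhamel (hp : p.IsEllipticWith C) (u₀ : GevreyH σ 2) {u : ℝ → GevreyH σ 2}
    (hu : Continuous u) (t : ℝ) :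
    hat (evolve p t u₀ + ∫ r in (0 : ℝ)..t, evolve p (t - r) (nonlin hp (u r))).toL2 =ᵐ[volume]
      fun ξ => Complex.exp (-Complex.I * t * p.phi ξ) * hat u₀.toL2 ξ - Complex.I *
        ∫ r in (0 : ℝ)..t, Complex.exp (-Complex.I * (t - r) * p.phi ξ) * p.nonlinHat (u r) ξ := by
  have hN : Measurable (Function.uncurry fun r => p.nonlinHat (u r)) :=
    measurable_uncurry_of_continuous_of_measurable
      (fun ξ => (continuous_nonlinHat_apply hp ξ).comp hu) fun r => measurable_nonlinHat p (u r)
  have hφ := p.measurable_phi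
  have hint := hat_intervalIntegral (G := fun r => evolve p (t - r) (nonlin hp (u r)))
    (h := fun r ξ => -Complex.I *
      (Complex.exp (-Complex.I * (t - r) * p.phi ξ) * p.nonlinHat (u r) ξ))
    ((isStronglyContinuousGroup_evolve p).continuous_uncurry.comp₂ (by fun_prop)
      ((continuous_nonlin hp).comp hu))
    (by simp only [Function.uncurry_def] at hN ⊢; fun_prop) (fun r => by
      filter_upwards [hat_evolve p (t - r) (nonlin hp (u r)), hat_nonlin hp (u r)] with ξ h1 h2
      rw [h1, h2, mul_left_comm, Complex.ofReal_sub]) 0 t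
  filter_upwards [hint, hat_evolve p t u₀, hat_toL2_add (evolve p t u₀)
    (∫ r in (0 : ℝ)..t, evolve p (t - r) (nonlin hp (u r)))] with ξ h1 h2 h3
  rw [h3, h2, h1, intervalIntegral.integral_const_mul]
  ring

end GevreyH

theorem extendZero_of_mem {T : ℝ} (hT : 0 ≤ T) (η : C(Icc (0 : ℝ) T, GevreyH σ 2)) {r : ℝ}
    (hr : r ∈ Icc 0 T) : extendZero η r = IccExtend hT η r := by
  rw [extendZero, dif_pos hr, IccExtend_of_mem hT _ hr]

theorem isMildSolution_iff_isDuhamelSolution (hp : p.IsEllipticWith C) {T : ℝ} (hT : 0 ≤ T)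
    (u₀ : GevreyH σ 2) (η : C(Icc (0 : ℝ) T, GevreyH σ 2)) :
    IsMildSolution p u₀ η ↔
      IsDuhamelSolution (GevreyH.evolve p) (GevreyH.nonlin hp) hT u₀ η := by
  refine forall_congr' fun t => ?_
  have hext (ξ : ℝ) : ∫ r in (0 : ℝ)..t, Complex.exp (-Complex.I * ((t : ℝ) - r) * p.phi ξ) *
        p.nonlinHat (extendZero η r) ξ =
      ∫ r in (0 : ℝ)..t, Complex.exp (-Complex.I * ((t : ℝ) - r) * p.phi ξ) *
        p.nonlinHat (IccExtend hT η r) ξ := by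
    refine intervalIntegral.integral_congr fun r hr => ?_
    simp only [extendZero_of_mem hT η (uIcc_subset_Icc ⟨le_rfl, hT⟩ t.2 hr)]
  simp only [hext]
  have hduh := GevreyH.hat_duhamel hp u₀ (u := IccExtend hT η) η.continuous.Icc_extend' t
  refine ⟨fun h => GevreyH.ext_hat (Filter.EventuallyEq.trans h hduh.symm), fun h => ?_⟩
  rw [h]
  exact hduh

theorem exists_solutionMap (hp : p.IsEllipticWith C) (σ : ℝ) {R T : ℝ} (hR : 1 ≤ R) (hT : 0 ≤ T)
    (hRT : 12 * (√Real.pi * ((3 + 2 * |p.γ|) * C)) * R ^ 2 * T ≤ 1) :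
    ∃ Φ : GevreyH σ 2 → C(Icc (0 : ℝ) T, GevreyH σ 2),
      ContinuousOn Φ (Metric.closedBall 0 R) ∧
      ∀ u₀ ∈ Metric.closedBall (0 : GevreyH σ 2) R, ∀ η : C(Icc (0 : ℝ) T, GevreyH σ 2),
        IsMildSolution p u₀ η ↔ η = Φ u₀ := by
  have hC := hp.pos
  lift R to NNReal using zero_le_one.trans hR
  have hK : 0 ≤ √Real.pi * ((3 + 2 * |p.γ|) * C) := by positivity
  simp only [isMildSolution_iff_isDuhamelSolution hp hT]
  refine exists_continuousOn_isDuhamelSolution_iff (GevreyH.isStronglyContinuousGroup_evolve p)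
    (GevreyH.lipschitzOnWith_nonlin hp σ) (GevreyH.nonlin_zero hp) hT (hRT.trans' ?_)
  rw [Real.coe_toNNReal _ (by positivity)]
  nlinarith [mul_nonneg (mul_nonneg hK hT) (mul_nonneg R.coe_nonneg (sub_nonneg.2 hR))]

end MildSolution

end KdVBBM

end

theorem theorem2_general (p : KdVBBM.Coeffs) (hγ₁ : -2 * √p.δ₁ < p.γ₁) (hδ₁ : 0 < p.δ₁) :
    ∃ c : ℝ, 0 < c ∧
      ∀ (σ : ℝ) (η₀ : KdVBBM.GevreyH σ 2) (T : ℝ), T = c * ((1 + ‖η₀‖) ^ 2)⁻¹ →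
        (∃! η : C(Set.Icc (0 : ℝ) T, KdVBBM.GevreyH σ 2), KdVBBM.IsMildSolution p η₀ η) ∧
        ∃ U : Set (KdVBBM.GevreyH σ 2), IsOpen U ∧ Metric.closedBall 0 ‖η₀‖ ⊆ U ∧
          ∃ Φ : KdVBBM.GevreyH σ 2 → C(Set.Icc (0 : ℝ) T, KdVBBM.GevreyH σ 2),
            ContinuousOn Φ U ∧
            ∀ u₀ ∈ U, ∀ η : C(Set.Icc (0 : ℝ) T, KdVBBM.GevreyH σ 2),
              KdVBBM.IsMildSolution p u₀ η ↔ η = Φ u₀ := by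
  obtain ⟨C, hp⟩ := p.exists_isEllipticWith hγ₁ hδ₁
  have hC := hp.pos
  refine ⟨(12 * (√Real.pi * ((3 + 2 * |p.γ|) * C)))⁻¹, by positivity, fun σ η₀ T hT => ?_⟩
  have hR : 1 ≤ 1 + ‖η₀‖ := le_add_of_nonneg_right (norm_nonneg η₀)
  have hT0 : 0 ≤ T := hT ▸ by positivity
  have hRT : 12 * (√Real.pi * ((3 + 2 * |p.γ|) * C)) * (1 + ‖η₀‖) ^ 2 * T = 1 := by
    rw [hT]
    field_simp
  obtain ⟨Φ, hΦ, hsol⟩ := KdVBBM.exists_solutionMap hp σ hR hT0 hRT.le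
  have hη₀ : η₀ ∈ Metric.closedBall (0 : KdVBBM.GevreyH σ 2) (1 + ‖η₀‖) :=
    mem_closedBall_zero_iff.2 (le_add_of_nonneg_left zero_le_one)
  exact ⟨⟨Φ η₀, (hsol η₀ hη₀ _).2 rfl, fun η => (hsol η₀ hη₀ η).1⟩,
    Metric.ball 0 (1 + ‖η₀‖), Metric.isOpen_ball,
    Metric.closedBall_subset_ball (lt_one_add ‖η₀‖), Φ, hΦ.mono Metric.ball_subset_closedBall,
    fun u₀ hu₀ => hsol u₀ (Metric.ball_subset_closedBall hu₀)⟩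

theorem theorem2 (p : KdVBBM.Coeffs) (hγ₁ : 0 < p.γ₁) (hδ₁ : 0 < p.δ₁) :
    ∃ c : ℝ, 0 < c ∧
      ∀ (σ₀ : ℝ), 0 < σ₀ → ∀ (η₀ : KdVBBM.GevreyH σ₀ 2) (T : ℝ),
        T = c * ((1 + ‖η₀‖) ^ 2)⁻¹ →
        (∃! η : C(Set.Icc (0 : ℝ) T, KdVBBM.GevreyH σ₀ 2), KdVBBM.IsMildSolution p η₀ η) ∧
        ∃ U : Set (KdVBBM.GevreyH σ₀ 2), IsOpen U ∧ Metric.closedBall 0 ‖η₀‖ ⊆ U ∧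
          ∃ Φ : KdVBBM.GevreyH σ₀ 2 → C(Set.Icc (0 : ℝ) T, KdVBBM.GevreyH σ₀ 2),
            ContinuousOn Φ U ∧
            ∀ u₀ ∈ U, ∀ η : C(Set.Icc (0 : ℝ) T, KdVBBM.GevreyH σ₀ 2),
              KdVBBM.IsMildSolution p u₀ η ↔ η = Φ u₀ := by
  obtain ⟨c, hc, h⟩ := theorem2_general p (by linarith [Real.sqrt_nonneg p.δ₁]) hδ₁
  exact ⟨c, hc, fun σ₀ _ => h σ₀⟩
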